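/- Let $R$ be a commutative ring with unit and $E=(E^0,E^1,r,s)$ an arbitrary directed graph. The Leavitt path algebra $L_R(E)$ is the associative (not necessarily unital) $R$-algebra generated by pairwise orthogonal idempotents $v\in E^0$ and elements $e,e^*$ $(e\in E^1)$ subject to $s(e)e=e=e\,r(e)$, $r(e)e^*=e^*=e^*s(e)$, $e^*e=r(e)$, $e^*f=0$ for $e\ne f$ in $E^1$, and $v=\sum_{s(e)=v}ee^*$ for every regular vertex $v$, i.e. every $v$ with $0<|s^{-1}(v)|<\infty$. It is $\mathbb Z$-graded by $\deg v=0$, $\deg e=1$, $\deg e^*=-1$; an ideal $A$ is graded if it is the direct sum of its intersections with the homogeneous components. A set $H\subseteq E^0$ is hereditary if $r(p)\in H$ for every path $p$ with $s(p)\in H$, and saturated if every regular vertex $v$ with $r(s^{-1}(v))\subseteq H$ lies in $H$. Let $B_H$ be the set of vertices $v\notin H$ with $|s^{-1}(v)|=\infty$ and $0<|s^{-1}(v)\cap r^{-1}(E^0\setminus H)|<\infty$; for $v\in B_H$ put $v^H=v-\sum_{s(e)=v,\ r(e)\notin H}ee^*$. An admissible pair is a pair $(H,S)$ with $H$ hereditary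 and saturated and $S\subseteq B_H$. The quotient graph $E\setminus(H,S)$ has vertices $(E^0\setminus H)\cup\{v':v\in B_H\setminus S\}$ and edges $\{e\in E^1:r(e)\notin H\}\cup\{e':e\in E^1,\ r(e)\in B_H\setminus S\}$, where the $v'$ and $e'$ are new symbols, $r$ and $s$ are as in $E$ on the old edges, and $s(e')=s(e)$, $r(e')=r(e)'$. For a graded two-sided ideal $A$ of $L_R(E)$, the associated saturated function $f$ assigns to each admissible pair $(H,S)\ne(\emptyset,\emptyset)$ the ideal $$f(H,S)=\{c\in R: cv\in A\text{ for all }v\in H\text{ and }cw^H\in A\text{ for all }w\in S\}$$ of $R$. For an ideal $I$ of $R$, a graded ideal $A$ is called $I$-basic if the image of $f$ is $\{I,R\}$ or $\{I\}$. **Corollary.** Let $A$ be an $I$-basic graded ideal of $L_R(E)$, and put $H=A\cap E^0=\{v\in E^0: v\in A\}$ and $S=\{v\in B_H: v^H\in A\}$. Then $(H,S)$ is an admissible pair, the ideal $I$ annihilates $L_R(E)/A$, so that $L_R(E)/A$ is an $R/I$-algebra via $(c+I)(x+A)=cx+A$, and $$L_R(E)/A\;\cong\;L_{R/I}\bigl(E\setminus(H,S)\bigr)$$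 as $R/I$-algebras. -/

import Mathlib

universe u v w

/-- A directed graph `(E⁰, E¹, s, r)`; loops, multiple edges and infinitely many vertices and edges
are allowed. -/
structure DirectedGraph where
  Vertex : Type u
  Edge : Type v
  /-- the source map -/
  s : Edge → Vertex
  /-- the range map -/
  r : Edge → Vertex

namespace DirectedGraph

instance (E : DirectedGraph.{u, v}) : Quiver.{v} E.Vertex where
  Hom a b := {e : E.Edge // E.s e = a ∧ E.r e = b}

variable (E : DirectedGraph.{u, v})

/-- A regular vertex emits at least one and only finitely many edges. -/
def IsRegular (a : E.Vertex) : Prop :=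
  {e : E.Edge | E.s e = a}.Nonempty ∧ {e : E.Edge | E.s e = a}.Finite

/-- An infinite emitter emits infinitely many edges. -/
def IsInfiniteEmitter (a : E.Vertex) : Prop := {e : E.Edge | E.s e = a}.Infinite

/-- `H` is hereditary: if `a ∈ H` and there is a (possibly trivial) path from `a` to `b`,
then `b ∈ H`. -/
def IsHereditary (H : Set E.Vertex) : Prop :=
  ∀ ⦃a b : E.Vertex⦄, a ∈ H → Nonempty (Quiver.Path a b) → b ∈ H

/-- `H` is closed under saturation: a regular vertex all of whose edges have range in `H` is
in `H`. -/
def IsSaturated (H : Set E.Vertex) : Prop :=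
  ∀ ⦃a : E.Vertex⦄, E.IsRegular a → (∀ e : E.Edge, E.s e = a → E.r e ∈ H) → a ∈ H

/-- The set `B_H` of breaking vertices of `H`: the infinite emitters outside `H` that emit at least
one and only finitely many edges with range outside `H`. -/
def breakingVertices (H : Set E.Vertex) : Set E.Vertex :=
  {a | a ∉ H ∧ E.IsInfiniteEmitter a ∧ {e : E.Edge | E.s e = a ∧ E.r e ∉ H}.Nonempty ∧
    {e : E.Edge | E.s e = a ∧ E.r e ∉ H}.Finite}

/-- An admissible pair `(H, S)`: `H` is hereditary and saturated and `S ⊆ B_H`. -/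
@[ext]
structure AdmissiblePair where
  H : Set E.Vertex
  S : Set E.Vertex
  hereditary : E.IsHereditary H
  saturated : E.IsSaturated H
  subset_breaking : S ⊆ E.breakingVertices H

/-- The set of all admissible pairs other than `(∅, ∅)`. -/
abbrev NontrivialPair : Type u := {p : E.AdmissiblePair // ¬ (p.H = ∅ ∧ p.S = ∅)}

variable {E} in
theorem AdmissiblePair.source_notMem (p : E.AdmissiblePair) {e : E.Edge} (he : E.r e ∉ p.H) :
    E.s e ∉ p.H := fun hs =>
  he (p.hereditary hs ⟨Quiver.Path.nil.cons ⟨e, rfl, rfl⟩⟩)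

variable {E} in
/-- The quotient graph `E \ (H, S)`. Its vertices are the vertices outside `H` (`Sum.inl`) and a new
vertex `a'` for each `a ∈ B_H \ S` (`Sum.inr`); its edges are the edges `e` with `r e ∉ H`
(`Sum.inl`) and a new edge `e'` from `s e` to `(r e)'` for each edge `e` with `r e ∈ B_H \ S`
(`Sum.inr`). -/
def AdmissiblePair.quotientGraph (p : E.AdmissiblePair) : DirectedGraph.{u, v} where
  Vertex := {a : E.Vertex // a ∉ p.H} ⊕ {a : E.Vertex // a ∈ E.breakingVertices p.H \ p.S}
  Edge := {e : E.Edge // E.r e ∉ p.H} ⊕ {e : E.Edge // E.r e ∈ E.breakingVertices p.H \ p.S}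
  s := Sum.elim (fun e => Sum.inl ⟨E.s e.1, p.source_notMem e.2⟩)
    (fun e => Sum.inl ⟨E.s e.1, p.source_notMem e.2.1.1⟩)
  r := Sum.elim (fun e => Sum.inl ⟨E.r e.1, e.2⟩) (fun e => Sum.inr ⟨E.r e.1, e.2⟩)

/-- The generators of a Leavitt path algebra: vertices `a`, edges `e`, ghost edges `e*`. -/
inductive Generator
  | vertex : E.Vertex → Generator
  | edge : E.Edge → Generator
  | ghost : E.Edge → Generator

end DirectedGraph

/-- The (in general non-unital) associative free `R`-algebra on the vertices, edges and ghost edges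
of `E`. -/
abbrev LeavittFreeAlgebra (R : Type w) [CommRing R] (E : DirectedGraph.{u, v}) :
    Type (max u v w) :=
  MonoidAlgebra R (FreeSemigroup E.Generator)

namespace LeavittFreeAlgebra

variable (R : Type w) [CommRing R] {E : DirectedGraph.{u, v}}

/-- A generator, as an element of the free algebra. -/
noncomputable def gen (g : E.Generator) : LeavittFreeAlgebra R E :=
  MonoidAlgebra.single (FreeSemigroup.of g) 1

/-- The vertex `a`, as an element of the free algebra. -/
noncomputable def V (a : E.Vertex) : LeavittFreeAlgebra R E := gen R (.vertex a)

/-- The edge `e`, as an element of the free algebra. -/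
noncomputable def D (e : E.Edge) : LeavittFreeAlgebra R E := gen R (.edge e)

/-- The ghost edge `e*`, as an element of the free algebra. -/
noncomputable def G (e : E.Edge) : LeavittFreeAlgebra R E := gen R (.ghost e)

/-- The defining relations of the Leavitt path algebra. -/
inductive Rel : LeavittFreeAlgebra R E → LeavittFreeAlgebra R E → Prop
  | vertex_idem (a : E.Vertex) : Rel (V R a * V R a) (V R a)
  | vertex_orthogonal (a b : E.Vertex) : a ≠ b → Rel (V R a * V R b) 0
  | source_edge (e : E.Edge) : Rel (V R (E.s e) * D R e) (D R e)
  | edge_range (e : E.Edge) : Rel (D R e * V R (E.r e)) (D R e)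
  | range_ghost (e : E.Edge) : Rel (V R (E.r e) * G R e) (G R e)
  | ghost_source (e : E.Edge) : Rel (G R e * V R (E.s e)) (G R e)
  | ck1_eq (e : E.Edge) : Rel (G R e * D R e) (V R (E.r e))
  | ck1_ne (e f : E.Edge) : e ≠ f → Rel (G R e * D R f) 0
  | ck2 (a : E.Vertex) (ha : E.IsRegular a) : Rel (V R a) (∑ e ∈ ha.2.toFinset, D R e * G R e)

variable (E) in
/-- The two-sided algebra ideal generated by the relations: as the free algebra has no unit,
all scalar multiples of the relations are put into the generating set. -/
noncomputable def relIdeal : TwoSidedIdeal (LeavittFreeAlgebra R E) :=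
  TwoSidedIdeal.span {x | ∃ (c : R) (y z : LeavittFreeAlgebra R E), Rel R y z ∧ x = c • (y - z)}

variable {R} in
theorem smul_mem_relIdeal (c : R) {x : LeavittFreeAlgebra R E} (hx : x ∈ relIdeal R E) :
    c • x ∈ relIdeal R E := by
  induction hx using TwoSidedIdeal.span_induction with
  | mem x h =>
    obtain ⟨d, y, z, h, rfl⟩ := h
    exact TwoSidedIdeal.subset_span ⟨c * d, y, z, h, by rw [mul_smul]⟩
  | zero => rw [smul_zero]; exact TwoSidedIdeal.zero_mem _
  | add x y _ _ hx hy => rw [smul_add]; exact TwoSidedIdeal.add_mem _ hx hy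
  | neg x _ hx => rw [smul_neg]; exact TwoSidedIdeal.neg_mem _ hx
  | left_absorb a x _ hx => rw [← mul_smul_comm]; exact TwoSidedIdeal.mul_mem_left _ _ _ hx
  | right_absorb b x _ hx => rw [← smul_mul_assoc]; exact TwoSidedIdeal.mul_mem_right _ _ _ hx

end LeavittFreeAlgebra

/-- If a two-sided ideal `J` of an `R`-algebra `B` is stable under scalars, then `B / J` is an
`R`-module with `c • (x + J) = c • x + J`. -/
@[reducible]
def TwoSidedIdeal.quotientModule {R B : Type*} [CommRing R] [NonUnitalRing B] [Module R B]
    (J : TwoSidedIdeal B) (h : ∀ (c : R) {x : B}, x ∈ J → c • x ∈ J) :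
    Module R J.ringCon.Quotient :=
  letI : SMul R J.ringCon.Quotient :=
    ⟨fun c => Quotient.map' (c • ·) (fun x y hxy => by
      have hxy' : J.ringCon x y := hxy
      change J.ringCon (c • x) (c • y)
      rw [TwoSidedIdeal.rel_iff] at hxy' ⊢
      rw [← smul_sub]
      exact h c hxy')⟩
  Function.Surjective.module R
    ({ toFun := fun x => (x : J.ringCon.Quotient), map_zero' := rfl, map_add' := fun _ _ => rfl } :
      B →+ J.ringCon.Quotient)
    Quotient.mk''_surjective (fun _ _ => rfl)

/-- The Leavitt path algebra `L_R(E)`: the `R`-algebra generated by the vertices, edges and ghost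
edges of `E`, subject to the defining relations. -/
def LeavittPathAlgebra (R : Type w) [CommRing R] (E : DirectedGraph.{u, v}) : Type (max u v w) :=
  (LeavittFreeAlgebra.relIdeal R E).ringCon.Quotient

namespace LeavittPathAlgebra

variable (R : Type w) [CommRing R] {E : DirectedGraph.{u, v}}

noncomputable instance : NonUnitalRing (LeavittPathAlgebra R E) :=
  inferInstanceAs (NonUnitalRing (LeavittFreeAlgebra.relIdeal R E).ringCon.Quotient)

noncomputable instance : Module R (LeavittPathAlgebra R E) :=
  TwoSidedIdeal.quotientModule (LeavittFreeAlgebra.relIdeal R E)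
    (fun c _ => LeavittFreeAlgebra.smul_mem_relIdeal c)

/-- The projection of the free algebra onto the Leavitt path algebra. -/
noncomputable def mk (x : LeavittFreeAlgebra R E) : LeavittPathAlgebra R E :=
  ((x : (LeavittFreeAlgebra.relIdeal R E).ringCon.Quotient))

theorem mk_surjective : Function.Surjective (mk R (E := E)) := Quotient.mk''_surjective

theorem mk_mul (x y : LeavittFreeAlgebra R E) : mk R (x * y) = mk R x * mk R y := rfl

theorem mk_add (x y : LeavittFreeAlgebra R E) : mk R (x + y) = mk R x + mk R y := rfl

theorem mk_zero : mk R (0 : LeavittFreeAlgebra R E) = 0 := rfl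

theorem mk_smul (c : R) (x : LeavittFreeAlgebra R E) : mk R (c • x) = c • mk R x := rfl

instance : IsScalarTower R (LeavittPathAlgebra R E) (LeavittPathAlgebra R E) where
  smul_assoc c x y := by
    obtain ⟨x, rfl⟩ := mk_surjective R x
    obtain ⟨y, rfl⟩ := mk_surjective R y
    simp only [smul_eq_mul, ← mk_smul, ← mk_mul, smul_mul_assoc]

instance : SMulCommClass R (LeavittPathAlgebra R E) (LeavittPathAlgebra R E) where
  smul_comm c x y := by
    obtain ⟨x, rfl⟩ := mk_surjective R x
    obtain ⟨y, rfl⟩ := mk_surjective R y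
    simp only [smul_eq_mul, ← mk_smul, ← mk_mul, mul_smul_comm]

/-- The vertex `a` in `L_R(E)`. -/
noncomputable def vertex (a : E.Vertex) : LeavittPathAlgebra R E := mk R (LeavittFreeAlgebra.V R a)

/-- The edge `e` in `L_R(E)`. -/
noncomputable def edge (e : E.Edge) : LeavittPathAlgebra R E := mk R (LeavittFreeAlgebra.D R e)

/-- The ghost edge `e*` in `L_R(E)`. -/
noncomputable def ghost (e : E.Edge) : LeavittPathAlgebra R E := mk R (LeavittFreeAlgebra.G R e)

theorem mk_rel {x y : LeavittFreeAlgebra R E} (h : LeavittFreeAlgebra.Rel R x y) :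
    mk R x = mk R y := by
  refine Quotient.sound' ((TwoSidedIdeal.rel_iff _ _ _).2 (TwoSidedIdeal.subset_span ?_))
  exact ⟨1, x, y, h, (one_smul _ _).symm⟩

theorem vertex_mul_self (a : E.Vertex) : vertex R a * vertex R a = vertex R a :=
  mk_rel R (.vertex_idem a)

theorem vertex_mul_vertex {a b : E.Vertex} (h : a ≠ b) : vertex R a * vertex R b = 0 :=
  mk_rel R (.vertex_orthogonal a b h)

theorem vertex_mul_edge (e : E.Edge) : vertex R (E.s e) * edge R e = edge R e :=
  mk_rel R (.source_edge e)

theorem edge_mul_vertex (e : E.Edge) : edge R e * vertex R (E.r e) = edge R e :=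
  mk_rel R (.edge_range e)

theorem vertex_mul_ghost (e : E.Edge) : vertex R (E.r e) * ghost R e = ghost R e :=
  mk_rel R (.range_ghost e)

theorem ghost_mul_vertex (e : E.Edge) : ghost R e * vertex R (E.s e) = ghost R e :=
  mk_rel R (.ghost_source e)

theorem ghost_mul_edge (e : E.Edge) : ghost R e * edge R e = vertex R (E.r e) :=
  mk_rel R (.ck1_eq e)

theorem vertex_eq_sum (a : E.Vertex) (ha : E.IsRegular a) :
    vertex R a = ∑ e ∈ ha.2.toFinset, edge R e * ghost R e := by
  refine (mk_rel R (.ck2 a ha)).trans ?_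
  let φ : LeavittFreeAlgebra R E →+ LeavittPathAlgebra R E :=
    { toFun := mk R, map_zero' := rfl, map_add' := fun _ _ => rfl }
  exact map_sum φ _ _

/-- For a breaking vertex `a` of `H`, the element `a^H = a - ∑ e e*`, the sum being over the finitely
many edges `e` with source `a` and range outside `H`. -/
noncomputable def breakingElement (H : Set E.Vertex) (a : E.Vertex)
    (ha : a ∈ E.breakingVertices H) : LeavittPathAlgebra R E :=
  vertex R a - ∑ e ∈ ha.2.2.2.toFinset, edge R e * ghost R e

/-- The element of `L_R(E)` given by a path `α`. -/
noncomputable def path {a : E.Vertex} : {b : E.Vertex} → Quiver.Path a b → LeavittPathAlgebra R E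
  | _, .nil => vertex R a
  | _, .cons p e => path p * edge R e.1

/-- The element of `L_R(E)` given by the ghost path `α*`. -/
noncomputable def ghostPath {a : E.Vertex} :
    {b : E.Vertex} → Quiver.Path a b → LeavittPathAlgebra R E
  | _, .nil => vertex R a
  | _, .cons p e => ghost R e.1 * ghostPath p

variable (E) in
/-- The homogeneous component of degree `n`: the `R`-span of the elements `α β*` with
`|α| - |β| = n`. Only paths with `r(α) = r(β)` are listed, since `α β* = 0` otherwise. -/
noncomputable def homogeneous (n : ℤ) : Submodule R (LeavittPathAlgebra R E) :=
  Submodule.span R {x | ∃ (a b c : E.Vertex) (α : Quiver.Path a c) (β : Quiver.Path b c),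
    (α.length : ℤ) - (β.length : ℤ) = n ∧ x = path R α * ghostPath R β}

/-- `L_R(E)` has local units. -/
theorem exists_local_unit (x : LeavittPathAlgebra R E) :
    ∃ T : Finset E.Vertex, ∀ F : Finset E.Vertex, T ⊆ F → (∑ a ∈ F, vertex R a) * x = x := by
  classical
  have key : ∀ (a : E.Vertex) (z : LeavittPathAlgebra R E), vertex R a * z = z →
      ∃ T : Finset E.Vertex, ∀ F : Finset E.Vertex, T ⊆ F → (∑ b ∈ F, vertex R b) * z = z := by
    intro a z hz
    refine ⟨{a}, fun F hF => ?_⟩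
    rw [Finset.sum_mul, Finset.sum_eq_single a, hz]
    · intro b _ hb
      rw [← hz, ← mul_assoc, vertex_mul_vertex R hb, zero_mul]
    · intro h
      exact absurd (hF (Finset.mem_singleton_self a)) h
  have hgen : ∀ g : E.Generator, ∃ a : E.Vertex,
      vertex R a * mk R (LeavittFreeAlgebra.gen R g) = mk R (LeavittFreeAlgebra.gen R g) := by
    rintro (a | e | e)
    · exact ⟨a, vertex_mul_self R a⟩
    · exact ⟨E.s e, vertex_mul_edge R e⟩
    · exact ⟨E.r e, vertex_mul_ghost R e⟩
  obtain ⟨x, rfl⟩ := mk_surjective R x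
  induction x using MonoidAlgebra.induction_linear with
  | zero => exact ⟨∅, fun F _ => by rw [mk_zero, mul_zero]⟩
  | add x y hx hy =>
    obtain ⟨T, hT⟩ := hx
    obtain ⟨U, hU⟩ := hy
    refine ⟨T ∪ U, fun F hF => ?_⟩
    rw [mk_add, mul_add, hT F (Finset.union_subset_left hF), hU F (Finset.union_subset_right hF)]
  | single w c =>
    induction w using FreeSemigroup.recOnMul with
    | ih1 g =>
      obtain ⟨a, ha⟩ := hgen g
      refine key a _ ?_
      have : (MonoidAlgebra.single (FreeSemigroup.of g) c : LeavittFreeAlgebra R E) =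
          c • LeavittFreeAlgebra.gen R g := by
        simp [LeavittFreeAlgebra.gen]
      rw [this, mk_smul, mul_smul_comm, ha]
    | ih2 g w _ _ =>
      obtain ⟨a, ha⟩ := hgen g
      refine key a _ ?_
      have : (MonoidAlgebra.single (FreeSemigroup.of g * w) c : LeavittFreeAlgebra R E) =
          LeavittFreeAlgebra.gen R g * MonoidAlgebra.single w c := by
        simp [LeavittFreeAlgebra.gen]
      rw [this, mk_mul, ← mul_assoc, ha]

variable {R}

/-- Every two-sided ring ideal of `L_R(E)` is stable under scalars. -/
theorem smul_mem (A : TwoSidedIdeal (LeavittPathAlgebra R E)) (c : R) {x : LeavittPathAlgebra R E}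
    (hx : x ∈ A) : c • x ∈ A := by
  obtain ⟨T, hT⟩ := exists_local_unit R x
  rw [← hT T subset_rfl, ← smul_mul_assoc]
  exact A.mul_mem_left _ _ hx

/-- An ideal of `L_R(E)`, as an `R`-submodule. -/
noncomputable def toSubmodule (A : TwoSidedIdeal (LeavittPathAlgebra R E)) :
    Submodule R (LeavittPathAlgebra R E) where
  carrier := {x | x ∈ A}
  add_mem' := A.add_mem
  zero_mem' := A.zero_mem
  smul_mem' c _ hx := smul_mem A c hx

/-- The ideal `A` is graded: it is the sum (necessarily direct) of its intersections with the
homogeneous components of `L_R(E)`. -/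
def IsGraded (A : TwoSidedIdeal (LeavittPathAlgebra R E)) : Prop :=
  toSubmodule A = ⨆ n : ℤ, toSubmodule A ⊓ homogeneous R E n

/-- The saturated function `f` associated to `A`, from the admissible pairs other than `(∅, ∅)` to
the ideals of `R`:
`f (H, S) = {c ∈ R | c a ∈ A for all a ∈ H, and c a^H ∈ A for all a ∈ S}`. -/
def saturatedFunction (A : TwoSidedIdeal (LeavittPathAlgebra R E)) (p : E.NontrivialPair) :
    Ideal R where
  carrier := {c | (∀ a ∈ p.1.H, c • vertex R a ∈ A) ∧
    ∀ (a : E.Vertex) (ha : a ∈ p.1.S),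
      c • breakingElement R p.1.H a (p.1.subset_breaking ha) ∈ A}
  add_mem' hc hd := ⟨fun a ha => by rw [add_smul]; exact A.add_mem (hc.1 a ha) (hd.1 a ha),
    fun a ha => by rw [add_smul]; exact A.add_mem (hc.2 a ha) (hd.2 a ha)⟩
  zero_mem' := ⟨fun a _ => by rw [zero_smul]; exact A.zero_mem,
    fun a _ => by rw [zero_smul]; exact A.zero_mem⟩
  smul_mem' d c hc := ⟨fun a ha => by rw [smul_assoc]; exact smul_mem A d (hc.1 a ha),
    fun a ha => by rw [smul_assoc]; exact smul_mem A d (hc.2 a ha)⟩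

/-- `A` is an `I`-basic graded ideal: it is graded and the image of its saturated function is
`{I, R}` or `{I}`. -/
structure IsBasicGraded (A : TwoSidedIdeal (LeavittPathAlgebra R E)) (I : Ideal R) : Prop where
  graded : IsGraded A
  image : Set.range (saturatedFunction A) = {I, ⊤} ∨ Set.range (saturatedFunction A) = {I}

/-- The pair `(H, S)` of an ideal `A`: `H = A ∩ E⁰` and `S = {a ∈ B_H | a^H ∈ A}`. -/
def idealPair (A : TwoSidedIdeal (LeavittPathAlgebra R E)) : E.AdmissiblePair where
  H := {a | vertex R a ∈ A}
  S := {a | ∃ ha : a ∈ E.breakingVertices {b | vertex R b ∈ A},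
    breakingElement R {b | vertex R b ∈ A} a ha ∈ A}
  hereditary := by
    rintro a b ha ⟨p⟩
    induction p with
    | nil => exact ha
    | cons p e ih =>
      obtain ⟨e, rfl, rfl⟩ := e
      change vertex R (E.r e) ∈ A
      rw [← ghost_mul_edge, ← ghost_mul_vertex, mul_assoc]
      exact A.mul_mem_left _ _ (A.mul_mem_right _ _ ih)
  saturated := by
    intro a ha h
    change vertex R a ∈ A
    rw [vertex_eq_sum R a ha]
    refine sum_mem fun e he => ?_
    rw [← edge_mul_vertex]
    exact A.mul_mem_right _ _ (A.mul_mem_left _ _ (h e (by simpa using he)))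
  subset_breaking := fun _ ha => ha.1

/-- The quotient algebra `L_R(E) / A`. -/
def QuotientAlgebra (A : TwoSidedIdeal (LeavittPathAlgebra R E)) : Type (max u v w) :=
  A.ringCon.Quotient

noncomputable instance (A : TwoSidedIdeal (LeavittPathAlgebra R E)) :
    NonUnitalRing (QuotientAlgebra A) :=
  inferInstanceAs (NonUnitalRing A.ringCon.Quotient)

noncomputable instance (A : TwoSidedIdeal (LeavittPathAlgebra R E)) :
    Module R (QuotientAlgebra A) :=
  TwoSidedIdeal.quotientModule A (fun c _ => smul_mem A c)

/-- If `A` is `I`-basic, then `I` annihilates `L_R(E) / A`. -/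
theorem IsBasicGraded.isTorsionBySet {A : TwoSidedIdeal (LeavittPathAlgebra R E)} {I : Ideal R}
    (h : IsBasicGraded A I) : Module.IsTorsionBySet R (QuotientAlgebra A) (I : Set R) := by
  rintro x ⟨c, hc⟩
  have hv : ∀ a : E.Vertex, c • vertex R a ∈ A := by
    intro a
    let p : E.NontrivialPair :=
      ⟨⟨Set.univ, ∅, fun _ _ _ _ => trivial, fun _ _ _ => trivial, Set.empty_subset _⟩,
        fun h => (Set.eq_empty_iff_forall_notMem.1 h.1 a) trivial⟩
    have hp : saturatedFunction A p ∈ Set.range (saturatedFunction A) := ⟨p, rfl⟩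
    have hI : I ≤ saturatedFunction A p := by
      rcases h.image with h | h <;> rw [h] at hp
      · rcases hp with hp | hp
        · exact hp.ge
        · exact le_top.trans (ge_of_eq hp)
      · exact (Set.mem_singleton_iff.1 hp).ge
    exact (hI hc).1 a trivial
  obtain ⟨x, rfl⟩ := Quotient.mk''_surjective x
  change ((c • x : LeavittPathAlgebra R E) : A.ringCon.Quotient) =
    ((0 : LeavittPathAlgebra R E) : A.ringCon.Quotient)
  refine Quotient.sound' ((TwoSidedIdeal.mem_iff A _).1 ?_)
  obtain ⟨T, hT⟩ := exists_local_unit R x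
  rw [← hT T subset_rfl, ← smul_mul_assoc, Finset.smul_sum]
  exact A.mul_mem_right _ _ (sum_mem fun a _ => hv a)

/-- For an `I`-basic graded ideal `A`, the `R/I`-module structure
`(c + I) • (x + A) = c • x + A` of `L_R(E) / A`. -/
@[reducible]
noncomputable def IsBasicGraded.module {A : TwoSidedIdeal (LeavittPathAlgebra R E)} {I : Ideal R}
    (h : IsBasicGraded A I) : Module (R ⧸ I) (QuotientAlgebra A) :=
  h.isTorsionBySet.module

end LeavittPathAlgebra

/-! The isomorphism is obtained as the inverse of a map ψ from `L_{R/I}(E \ (H, S))` to `L_R(E) /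
A`, given by the universal property. In the quotient graph a vertex `a ∈ B_H \ S` becomes two
vertices `a` and `a'`. In `L_R(E)` the idempotent `a` splits accordingly as `P + a^H`, with `P = ∑ e
e*` over the finitely many edges from `a` to vertices outside `H`. So ψ sends `a` to `P`, `a'` to
`a^H`, every other vertex to itself, and `e` and `e'` to `e` times the idempotent of their range
(`quotientFamily`). All relations except the last hold already in `L_R(E)`; the relation at regular
vertices holds modulo `A` by `mainVertex_sub_edgeProj_mem`. Surjectivity is clear, since each
generator of `L_R(E)` lies in `A` or is a sum of at most two images, up to elements of `A`.

Injectivity is a graded uniqueness argument over `R/I`. If an ideal `K` contains `c • v` only for `c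
= 0`, then it contains no nonzero homogeneous element (`eq_zero_of_mem_monomialSpan`): multiplying
by ghost edges on the left and edges on the right shortens an element until only multiples of
vertices are left. Two facts make this applicable to the kernel of ψ. The kernel contains the
components of its elements, because homogeneous elements have images with homogeneous lifts to
`L_R(E)` and `A` is graded. And if `c` times the idempotent of a vertex of the quotient graph lies
in `A`, then `c ∈ I` (`IsBasicGraded.mem_of_smul_quotientVertex_mem`): there is an admissible pair
whose value under `f` contains `c` or a consequence of it but not `1`, and this value must be `I`.
-/

/-! ### Universal property of the Leavitt path algebra. -/

/-- A family of elements of a non-unital ring that satisfies the relations defining the Leavitt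
path algebra of `E`. -/
structure LeavittFamily (E : DirectedGraph.{u, v}) (B : Type*) [NonUnitalRing B] where
  vertex : E.Vertex → B
  edge : E.Edge → B
  ghost : E.Edge → B
  vertex_mul_self : ∀ a, vertex a * vertex a = vertex a
  vertex_mul_vertex : ∀ a b, a ≠ b → vertex a * vertex b = 0
  vertex_mul_edge : ∀ e, vertex (E.s e) * edge e = edge e
  edge_mul_vertex : ∀ e, edge e * vertex (E.r e) = edge e
  vertex_mul_ghost : ∀ e, vertex (E.r e) * ghost e = ghost e
  ghost_mul_vertex : ∀ e, ghost e * vertex (E.s e) = ghost e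
  ghost_mul_edge : ∀ e, ghost e * edge e = vertex (E.r e)
  ghost_mul_edge_of_ne : ∀ e f, e ≠ f → ghost e * edge f = 0
  vertex_eq_sum : ∀ a (ha : E.IsRegular a), vertex a = ∑ e ∈ ha.2.toFinset, edge e * ghost e

namespace LeavittFamily

variable {R : Type w} [CommRing R] {E : DirectedGraph.{u, v}} {B : Type*} [NonUnitalRing B]

/-- The value of a family at a generator. -/
def onGenerator (X : LeavittFamily E B) : E.Generator → B
  | .vertex a => X.vertex a
  | .edge e => X.edge e
  | .ghost e => X.ghost e

variable [Module R B] [IsScalarTower R B B] [SMulCommClass R B B]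

variable (R) in
/-- The extension of a family to the free algebra. -/
noncomputable def freeLift (X : LeavittFamily E B) : LeavittFreeAlgebra R E →ₙₐ[R] B :=
  MonoidAlgebra.liftMagma R (FreeSemigroup.lift X.onGenerator)

theorem freeLift_gen (X : LeavittFamily E B) (g : E.Generator) :
    X.freeLift R (LeavittFreeAlgebra.gen R g) = X.onGenerator g := by
  simp [freeLift, LeavittFreeAlgebra.gen]

theorem freeLift_rel (X : LeavittFamily E B) {x y : LeavittFreeAlgebra R E}
    (h : LeavittFreeAlgebra.Rel R x y) : X.freeLift R x = X.freeLift R y := by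
  have hV : ∀ a, X.freeLift R (LeavittFreeAlgebra.V R a) = X.vertex a :=
    fun a => X.freeLift_gen _
  have hD : ∀ e, X.freeLift R (LeavittFreeAlgebra.D R e) = X.edge e :=
    fun e => X.freeLift_gen _
  have hG : ∀ e, X.freeLift R (LeavittFreeAlgebra.G R e) = X.ghost e :=
    fun e => X.freeLift_gen _
  induction h with
  | vertex_idem a => simp only [map_mul, hV, X.vertex_mul_self]
  | vertex_orthogonal a b h => simp only [map_mul, map_zero, hV, X.vertex_mul_vertex a b h]
  | source_edge e => simp only [map_mul, hV, hD, X.vertex_mul_edge]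
  | edge_range e => simp only [map_mul, hV, hD, X.edge_mul_vertex]
  | range_ghost e => simp only [map_mul, hV, hG, X.vertex_mul_ghost]
  | ghost_source e => simp only [map_mul, hV, hG, X.ghost_mul_vertex]
  | ck1_eq e => simp only [map_mul, hV, hD, hG, X.ghost_mul_edge]
  | ck1_ne e f h => simp only [map_mul, map_zero, hD, hG, X.ghost_mul_edge_of_ne e f h]
  | ck2 a ha => simp only [map_sum, map_mul, hV, hD, hG]; exact X.vertex_eq_sum a ha

theorem freeLift_eq_zero (X : LeavittFamily E B) {x : LeavittFreeAlgebra R E}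
    (hx : x ∈ LeavittFreeAlgebra.relIdeal R E) : X.freeLift R x = 0 := by
  induction hx using TwoSidedIdeal.span_induction with
  | mem x h =>
    obtain ⟨c, y, z, h, rfl⟩ := h
    rw [map_smul, map_sub, X.freeLift_rel h, sub_self, smul_zero]
  | zero => exact map_zero _
  | add x y _ _ hx hy => rw [map_add, hx, hy, add_zero]
  | neg x _ hx => rw [map_neg, hx, neg_zero]
  | left_absorb a x _ hx => rw [map_mul, hx, mul_zero]
  | right_absorb b x _ hx => rw [map_mul, hx, zero_mul]

variable (R) in
/-- The universal property of the Leavitt path algebra. -/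
noncomputable def lift (X : LeavittFamily E B) : LeavittPathAlgebra R E →ₙₐ[R] B where
  toFun := Quotient.lift (X.freeLift R) fun x y h => by
    have h' : (LeavittFreeAlgebra.relIdeal R E).ringCon x y := h
    rw [TwoSidedIdeal.rel_iff] at h'
    rw [← sub_eq_zero, ← map_sub]
    exact X.freeLift_eq_zero h'
  map_smul' c x := by
    obtain ⟨x, rfl⟩ := LeavittPathAlgebra.mk_surjective R x
    exact map_smul (X.freeLift R) c x
  map_zero' := map_zero (X.freeLift R)
  map_add' x y := by
    obtain ⟨x, rfl⟩ := LeavittPathAlgebra.mk_surjective R x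
    obtain ⟨y, rfl⟩ := LeavittPathAlgebra.mk_surjective R y
    exact map_add (X.freeLift R) x y
  map_mul' x y := by
    obtain ⟨x, rfl⟩ := LeavittPathAlgebra.mk_surjective R x
    obtain ⟨y, rfl⟩ := LeavittPathAlgebra.mk_surjective R y
    exact map_mul (X.freeLift R) x y

@[simp]
theorem lift_vertex (X : LeavittFamily E B) (a : E.Vertex) :
    X.lift R (LeavittPathAlgebra.vertex R a) = X.vertex a := X.freeLift_gen _

@[simp]
theorem lift_edge (X : LeavittFamily E B) (e : E.Edge) :
    X.lift R (LeavittPathAlgebra.edge R e) = X.edge e := X.freeLift_gen _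

@[simp]
theorem lift_ghost (X : LeavittFamily E B) (e : E.Edge) :
    X.lift R (LeavittPathAlgebra.ghost R e) = X.ghost e := X.freeLift_gen _

end LeavittFamily

/-! ### Generation by vertices, edges and ghost edges; the grading. -/

namespace LeavittPathAlgebra

variable {R : Type w} [CommRing R] {E : DirectedGraph.{u, v}}

theorem ghost_mul_edge_of_ne {e f : E.Edge} (h : e ≠ f) : ghost R e * edge R f = 0 :=
  mk_rel R (.ck1_ne e f h)

theorem vertex_mul_edge_of_ne {a : E.Vertex} {e : E.Edge} (h : a ≠ E.s e) :
    vertex R a * edge R e = 0 := by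
  rw [← vertex_mul_edge, ← mul_assoc, vertex_mul_vertex R h, zero_mul]

theorem ghost_mul_vertex_of_ne {a : E.Vertex} {e : E.Edge} (h : E.s e ≠ a) :
    ghost R e * vertex R a = 0 := by
  rw [← ghost_mul_vertex, mul_assoc, vertex_mul_vertex R h, mul_zero]

/-- A submodule that contains the generators and is stable under left multiplication by the
generators is everything. -/
theorem eq_top_of_generators (N : Submodule R (LeavittPathAlgebra R E))
    (hv : ∀ a, vertex R a ∈ N) (he : ∀ e, edge R e ∈ N) (hg : ∀ e, ghost R e ∈ N)
    (hvm : ∀ a, ∀ x ∈ N, vertex R a * x ∈ N) (hem : ∀ e, ∀ x ∈ N, edge R e * x ∈ N)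
    (hgm : ∀ e, ∀ x ∈ N, ghost R e * x ∈ N) : N = ⊤ := by
  refine eq_top_iff.2 fun x _ => ?_
  obtain ⟨x, rfl⟩ := mk_surjective R x
  have hs : ∀ (w : FreeSemigroup E.Generator) (c : R),
      (MonoidAlgebra.single w c : LeavittFreeAlgebra R E) = c • MonoidAlgebra.single w 1 := by
    intro w c
    simp
  induction x using MonoidAlgebra.induction_linear with
  | zero => exact N.zero_mem
  | add x y hx hy => exact N.add_mem (hx trivial) (hy trivial)
  | single w c =>
    rw [hs, mk_smul]
    refine N.smul_mem c ?_
    clear * - hv he hg hvm hem hgm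
    induction w using FreeSemigroup.recOnMul with
    | ih1 g =>
      rcases g with a | e | e
      · exact hv a
      · exact he e
      · exact hg e
    | ih2 g w _ ih =>
      have : (MonoidAlgebra.single (FreeSemigroup.of g * w) 1 : LeavittFreeAlgebra R E) =
          LeavittFreeAlgebra.gen R g * MonoidAlgebra.single w 1 := by
        simp [LeavittFreeAlgebra.gen]
      rw [this, mk_mul]
      rcases g with a | e | e
      · exact hvm a _ ih
      · exact hem e _ ih
      · exact hgm e _ ih

/-! ### The degree homomorphism -/

open AddMonoidAlgebra in
variable (R E) in
/-- The generators of `L_R(E)`, marked by their degrees. -/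
noncomputable def degreeFamily :
    LeavittFamily E (AddMonoidAlgebra (Unitization R (LeavittPathAlgebra R E)) ℤ) where
  vertex a := single 0 (Unitization.inr (vertex R a))
  edge e := single 1 (Unitization.inr (edge R e))
  ghost e := single (-1) (Unitization.inr (ghost R e))
  vertex_mul_self a := by rw [single_mul_single, ← Unitization.inr_mul, vertex_mul_self]; rfl
  vertex_mul_vertex a b h := by
    rw [single_mul_single, ← Unitization.inr_mul, vertex_mul_vertex R h, Unitization.inr_zero, single_zero]
  vertex_mul_edge e := by rw [single_mul_single, ← Unitization.inr_mul, vertex_mul_edge]; rfl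
  edge_mul_vertex e := by rw [single_mul_single, ← Unitization.inr_mul, edge_mul_vertex]; rfl
  vertex_mul_ghost e := by rw [single_mul_single, ← Unitization.inr_mul, vertex_mul_ghost]; rfl
  ghost_mul_vertex e := by rw [single_mul_single, ← Unitization.inr_mul, ghost_mul_vertex]; rfl
  ghost_mul_edge e := by rw [single_mul_single, ← Unitization.inr_mul, ghost_mul_edge]; rfl
  ghost_mul_edge_of_ne e f h := by
    rw [single_mul_single, ← Unitization.inr_mul, ghost_mul_edge_of_ne h, Unitization.inr_zero, single_zero]
  vertex_eq_sum a ha := by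
    simp only [single_mul_single, ← Unitization.inr_mul, add_neg_cancel]
    rw [vertex_eq_sum R a ha]
    exact map_sum ((singleAddHom (0 : ℤ)).comp
      (Unitization.inrHom R R (LeavittPathAlgebra R E)).toAddMonoidHom) _ _

variable (R E) in
/-- The homomorphism that marks every homogeneous element by its degree. -/
noncomputable def degreeHom : LeavittPathAlgebra R E →ₙₐ[R]
    AddMonoidAlgebra (Unitization R (LeavittPathAlgebra R E)) ℤ :=
  (degreeFamily R E).lift R

variable (R E) in
/-- The elements of degree `n`. -/
noncomputable def degreeComponent (n : ℤ) : Submodule R (LeavittPathAlgebra R E) where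
  carrier := {x | degreeHom R E x = .single n (Unitization.inr x)}
  add_mem' {x y} hx hy := by
    simp only [Set.mem_ofPred_eq] at *
    rw [map_add, hx, hy, Unitization.inr_add, AddMonoidAlgebra.single_add]
  zero_mem' := by simp
  smul_mem' c x hx := by
    simp only [Set.mem_ofPred_eq] at *
    rw [map_smul, hx, Unitization.inr_smul, AddMonoidAlgebra.smul_single]

theorem mem_degreeComponent {n : ℤ} {x : LeavittPathAlgebra R E} :
    x ∈ degreeComponent R E n ↔ degreeHom R E x = .single n (Unitization.inr x) := Iff.rfl

theorem vertex_mem_degreeComponent (a : E.Vertex) : vertex R a ∈ degreeComponent R E 0 :=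
  (degreeFamily R E).lift_vertex a

theorem edge_mem_degreeComponent (e : E.Edge) : edge R e ∈ degreeComponent R E 1 :=
  (degreeFamily R E).lift_edge e

theorem ghost_mem_degreeComponent (e : E.Edge) : ghost R e ∈ degreeComponent R E (-1) :=
  (degreeFamily R E).lift_ghost e

theorem mul_mem_degreeComponent {m n : ℤ} {x y : LeavittPathAlgebra R E}
    (hx : x ∈ degreeComponent R E m) (hy : y ∈ degreeComponent R E n) :
    x * y ∈ degreeComponent R E (m + n) := by
  rw [mem_degreeComponent] at *
  rw [map_mul, hx, hy, AddMonoidAlgebra.single_mul_single, Unitization.inr_mul]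

theorem path_mem_degreeComponent {a b : E.Vertex} (p : Quiver.Path a b) :
    path R p ∈ degreeComponent R E p.length := by
  induction p with
  | nil => exact vertex_mem_degreeComponent a
  | cons p e ih =>
    rw [Quiver.Path.length_cons, Nat.cast_succ]
    exact mul_mem_degreeComponent ih (edge_mem_degreeComponent e.1)

theorem ghostPath_mem_degreeComponent {a b : E.Vertex} (p : Quiver.Path a b) :
    ghostPath R p ∈ degreeComponent R E (-p.length) := by
  induction p with
  | nil => exact vertex_mem_degreeComponent a
  | cons p e ih =>
    rw [Quiver.Path.length_cons, Nat.cast_succ, neg_add_rev]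
    exact mul_mem_degreeComponent (ghost_mem_degreeComponent e.1) ih

/-- Only this inclusion is needed. Independence of the components comes for free from the
coefficients in the group algebra of `ℤ`, so no basis of `L_R(E)` is required. -/
theorem homogeneous_le_degreeComponent (n : ℤ) : homogeneous R E n ≤ degreeComponent R E n := by
  refine Submodule.span_le.2 ?_
  rintro _ ⟨a, b, c, α, β, rfl, rfl⟩
  rw [sub_eq_add_neg]
  exact mul_mem_degreeComponent (path_mem_degreeComponent α) (ghostPath_mem_degreeComponent β)

/-- The component of degree `n` of an element. -/
theorem coeff_degreeHom_sum {s : Finset ℤ} {y : ℤ → LeavittPathAlgebra R E}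
    (hy : ∀ n ∈ s, y n ∈ degreeComponent R E n) {n : ℤ} (hn : n ∈ s) :
    (degreeHom R E (∑ m ∈ s, y m)).coeff n = Unitization.inr (y n) := by
  rw [map_sum, Finset.sum_congr rfl fun m hm => mem_degreeComponent.1 (hy m hm)]
  simp only [AddMonoidAlgebra.coeff_sum, AddMonoidAlgebra.coeff_single, Finsupp.finsetSum_apply, Finsupp.single_apply,
    Finset.sum_ite_eq', hn, if_true]

/-- A graded ideal contains the homogeneous components of its elements. -/
theorem IsGraded.mem_of_sum_mem {A : TwoSidedIdeal (LeavittPathAlgebra R E)} (hA : IsGraded A)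
    {s : Finset ℤ} {y : ℤ → LeavittPathAlgebra R E}
    (hy : ∀ n ∈ s, y n ∈ degreeComponent R E n) (hs : ∑ n ∈ s, y n ∈ A) {n : ℤ} (hn : n ∈ s) :
    y n ∈ A := by
  -- Every coefficient of the marked image of an element of `A` comes from `A`. This is clear for
  -- homogeneous elements of `A`, and by gradedness these span `A`.
  have key : ∀ x ∈ toSubmodule A, ∀ n : ℤ,
      ∃ z ∈ A, (degreeHom R E x).coeff n = Unitization.inr z := by
    intro x hx n
    rw [hA] at hx
    induction hx using Submodule.iSup_induction' with
    | mem m x hx =>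
      rw [mem_degreeComponent.1 (homogeneous_le_degreeComponent m hx.2)]
      by_cases h : m = n
      · subst h
        exact ⟨x, hx.1, by rw [AddMonoidAlgebra.coeff_single, Finsupp.single_eq_same]⟩
      · exact ⟨0, A.zero_mem, by
          rw [AddMonoidAlgebra.coeff_single, Finsupp.single_apply, if_neg h, Unitization.inr_zero]⟩
    | zero => exact ⟨0, A.zero_mem, by simp⟩
    | add x y _ _ hx hy =>
      obtain ⟨z, hz, hxz⟩ := hx
      obtain ⟨t, ht, hyt⟩ := hy
      exact ⟨z + t, A.add_mem hz ht, by simp [hxz, hyt]⟩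
  obtain ⟨z, hz, h⟩ := key _ hs n
  rw [coeff_degreeHom_sum hy hn] at h
  rwa [Unitization.inr_injective h]

end LeavittPathAlgebra

/-! ### Monomials and their spans. -/

namespace LeavittPathAlgebra

variable {R : Type w} [CommRing R] {E : DirectedGraph.{u, v}}

variable (R E) in
/-- The monomials `e₁ ⋯ eₘ a fₙ* ⋯ f₁*`. -/
inductive IsMonomial : ℕ → ℕ → LeavittPathAlgebra R E → Prop
  | vertex (a : E.Vertex) : IsMonomial 0 0 (vertex R a)
  | edge_mul {m n : ℕ} {z : LeavittPathAlgebra R E} (e : E.Edge) :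
      IsMonomial m n z → IsMonomial (m + 1) n (edge R e * z)
  | mul_ghost {m n : ℕ} {z : LeavittPathAlgebra R E} (e : E.Edge) :
      IsMonomial m n z → IsMonomial m (n + 1) (z * ghost R e)

namespace IsMonomial

/-- Edges are attached on the left and ghost edges on the right, so the two operations commute by
associativity and an edge can always be made the outermost factor. -/
theorem exists_edge_mul {m n : ℕ} {z : LeavittPathAlgebra R E} (h : IsMonomial R E (m + 1) n z) :
    ∃ e y, IsMonomial R E m n y ∧ z = edge R e * y := by
  generalize hk : m + 1 = k at h
  induction h with
  | vertex a => omega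
  | edge_mul e h _ =>
    obtain rfl := Nat.succ_injective hk
    exact ⟨e, _, h, rfl⟩
  | mul_ghost f h ih =>
    obtain ⟨e, y, hy, rfl⟩ := ih hk
    exact ⟨e, _, hy.mul_ghost f, mul_assoc _ _ _⟩

theorem exists_mul_ghost {m n : ℕ} {z : LeavittPathAlgebra R E} (h : IsMonomial R E m (n + 1) z) :
    ∃ e y, IsMonomial R E m n y ∧ z = y * ghost R e := by
  generalize hk : n + 1 = k at h
  induction h with
  | vertex a => omega
  | mul_ghost e h _ =>
    obtain rfl := Nat.succ_injective hk
    exact ⟨e, _, h, rfl⟩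
  | edge_mul f h ih =>
    obtain ⟨e, y, hy, rfl⟩ := ih hk
    exact ⟨e, _, hy.edge_mul f, (mul_assoc _ _ _).symm⟩

/-- The source of the leftmost factor decides. Consecutive factors of a monomial need not be
composable, so the monomial itself may be zero. -/
theorem vertex_mul {m n : ℕ} {z : LeavittPathAlgebra R E} (h : IsMonomial R E m n z)
    (a : E.Vertex) : LeavittPathAlgebra.vertex R a * z = 0 ∨
      LeavittPathAlgebra.vertex R a * z = z := by
  induction h with
  | vertex b =>
    by_cases hab : a = b
    · exact .inr (hab ▸ vertex_mul_self R a)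
    · exact .inl (vertex_mul_vertex R hab)
  | edge_mul e h _ =>
    by_cases hae : a = E.s e
    · exact .inr (by rw [hae, ← mul_assoc, vertex_mul_edge])
    · exact .inl (by rw [← mul_assoc, vertex_mul_edge_of_ne hae, zero_mul])
  | mul_ghost e h ih =>
    rcases ih with ih | ih
    · exact .inl (by rw [← mul_assoc, ih, zero_mul])
    · exact .inr (by rw [← mul_assoc, ih])

theorem mul_vertex {m n : ℕ} {z : LeavittPathAlgebra R E} (h : IsMonomial R E m n z)
    (a : E.Vertex) : z * LeavittPathAlgebra.vertex R a = 0 ∨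
      z * LeavittPathAlgebra.vertex R a = z := by
  induction h with
  | vertex b =>
    by_cases hab : b = a
    · exact .inr (hab ▸ vertex_mul_self R b)
    · exact .inl (vertex_mul_vertex R hab)
  | mul_ghost e h _ =>
    by_cases hae : E.s e = a
    · exact .inr (by rw [← hae, mul_assoc, ghost_mul_vertex])
    · exact .inl (by rw [mul_assoc, ghost_mul_vertex_of_ne hae, mul_zero])
  | edge_mul e h ih =>
    rcases ih with ih | ih
    · exact .inl (by rw [mul_assoc, ih, mul_zero])
    · exact .inr (by rw [mul_assoc, ih])

theorem ghost_mul_of_succ {m n : ℕ} {z : LeavittPathAlgebra R E}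
    (h : IsMonomial R E (m + 1) n z) (e : E.Edge) :
    ghost R e * z = 0 ∨ IsMonomial R E m n (ghost R e * z) := by
  obtain ⟨f, y, hy, rfl⟩ := h.exists_edge_mul
  by_cases hef : e = f
  · subst hef
    rw [← mul_assoc, ghost_mul_edge]
    exact (hy.vertex_mul _).imp_right fun h => by rwa [h]
  · exact .inl (by rw [← mul_assoc, ghost_mul_edge_of_ne hef, zero_mul])

theorem mul_edge_of_succ {m n : ℕ} {z : LeavittPathAlgebra R E}
    (h : IsMonomial R E m (n + 1) z) (e : E.Edge) :
    z * edge R e = 0 ∨ IsMonomial R E m n (z * edge R e) := by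
  obtain ⟨f, y, hy, rfl⟩ := h.exists_mul_ghost
  by_cases hef : f = e
  · subst hef
    rw [mul_assoc, ghost_mul_edge]
    exact (hy.mul_vertex _).imp_right fun h => by rwa [h]
  · exact .inl (by rw [mul_assoc, ghost_mul_edge_of_ne hef, mul_zero])

variable (R) in
theorem edge (e : E.Edge) : IsMonomial R E 1 0 (edge R e) := by
  rw [← edge_mul_vertex]
  exact (vertex _).edge_mul e

variable (R) in
theorem ghost (e : E.Edge) : IsMonomial R E 0 1 (ghost R e) := by
  rw [← vertex_mul_ghost]
  exact (vertex _).mul_ghost e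

/-- Without edges to cancel, `e*` moves past the ghost edges to the vertex at the left end and
lengthens the ghost part. -/
theorem ghost_mul_of_zero {n : ℕ} {z : LeavittPathAlgebra R E}
    (h : IsMonomial R E 0 n z) (e : E.Edge) : LeavittPathAlgebra.ghost R e * z = 0 ∨
      IsMonomial R E 0 (n + 1) (LeavittPathAlgebra.ghost R e * z) := by
  generalize hk : 0 = k at h
  induction h with
  | vertex a =>
    by_cases ha : E.s e = a
    · subst ha
      exact .inr (by rw [ghost_mul_vertex]; exact ghost R e)
    · exact .inl (ghost_mul_vertex_of_ne ha)
  | edge_mul f h _ => omega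
  | mul_ghost f h ih =>
    rw [← mul_assoc]
    rcases ih hk with ih | ih
    · exact .inl (by rw [ih, zero_mul])
    · exact .inr (ih.mul_ghost f)

theorem mul_edge_of_zero {m : ℕ} {z : LeavittPathAlgebra R E}
    (h : IsMonomial R E m 0 z) (e : E.Edge) : z * LeavittPathAlgebra.edge R e = 0 ∨
      IsMonomial R E (m + 1) 0 (z * LeavittPathAlgebra.edge R e) := by
  generalize hk : 0 = k at h
  induction h with
  | vertex a =>
    by_cases ha : a = E.s e
    · subst ha
      exact .inr (by rw [vertex_mul_edge]; exact edge R e)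
    · exact .inl (vertex_mul_edge_of_ne ha)
  | mul_ghost f h _ => omega
  | edge_mul f h ih =>
    rw [mul_assoc]
    rcases ih hk with ih | ih
    · exact .inl (by rw [ih, mul_zero])
    · exact .inr (ih.edge_mul f)

end IsMonomial

variable (R E) in
/-- The span of the monomials of degree `d`. -/
noncomputable def monomialSpan (d : ℤ) : Submodule R (LeavittPathAlgebra R E) :=
  Submodule.span R {z | ∃ m n : ℕ, (m : ℤ) - n = d ∧ IsMonomial R E m n z}

variable (R E) in
/-- The span of the monomials of degree `0` and length at most `2 * k`. -/
noncomputable def diagonalSpan (k : ℕ) : Submodule R (LeavittPathAlgebra R E) :=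
  Submodule.span R {z | ∃ n ≤ k, IsMonomial R E n n z}

theorem IsMonomial.mem_monomialSpan {m n : ℕ} {d : ℤ} {z : LeavittPathAlgebra R E}
    (h : IsMonomial R E m n z) (hd : (m : ℤ) - n = d) : z ∈ monomialSpan R E d :=
  Submodule.subset_span ⟨m, n, hd, h⟩

theorem mul_mem_of_mem_span {N : Submodule R (LeavittPathAlgebra R E)}
    {s : Set (LeavittPathAlgebra R E)} {a x : LeavittPathAlgebra R E}
    (h : ∀ z ∈ s, a * z ∈ N) (hx : x ∈ Submodule.span R s) : a * x ∈ N :=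
  Submodule.span_le (p := N.comap (LinearMap.mulLeft R a)).2 h hx

theorem mem_mul_of_mem_span {N : Submodule R (LeavittPathAlgebra R E)}
    {s : Set (LeavittPathAlgebra R E)} {a x : LeavittPathAlgebra R E}
    (h : ∀ z ∈ s, z * a ∈ N) (hx : x ∈ Submodule.span R s) : x * a ∈ N :=
  Submodule.span_le (p := N.comap (LinearMap.mulRight R a)).2 h hx

theorem ghost_mul_mem_monomialSpan {d : ℤ} {x : LeavittPathAlgebra R E}
    (hx : x ∈ monomialSpan R E d) (e : E.Edge) : ghost R e * x ∈ monomialSpan R E (d - 1) := by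
  refine mul_mem_of_mem_span ?_ hx
  rintro z ⟨m, n, rfl, h⟩
  rcases m with _ | m
  · rcases h.ghost_mul_of_zero e with h | h
    · rw [h]; exact zero_mem _
    · exact h.mem_monomialSpan (by push_cast; ring)
  · rcases h.ghost_mul_of_succ e with h | h
    · rw [h]; exact zero_mem _
    · exact h.mem_monomialSpan (by push_cast; ring)

theorem mul_edge_mem_monomialSpan {d : ℤ} {x : LeavittPathAlgebra R E}
    (hx : x ∈ monomialSpan R E d) (e : E.Edge) : x * edge R e ∈ monomialSpan R E (d + 1) := by
  refine mem_mul_of_mem_span ?_ hx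
  rintro z ⟨m, n, rfl, h⟩
  rcases n with _ | n
  · rcases h.mul_edge_of_zero e with h | h
    · rw [h]; exact zero_mem _
    · exact h.mem_monomialSpan (by push_cast; ring)
  · rcases h.mul_edge_of_succ e with h | h
    · rw [h]; exact zero_mem _
    · exact h.mem_monomialSpan (by push_cast; ring)

variable (R E) in
theorem iSup_monomialSpan : ⨆ d, monomialSpan R E d = ⊤ := by
  have hspan : Submodule.span R {z | ∃ m n, IsMonomial R E m n z} = ⊤ := by
    refine eq_top_of_generators _ (fun a => Submodule.subset_span ⟨_, _, .vertex a⟩)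
      (fun e => Submodule.subset_span ⟨_, _, .edge R e⟩)
      (fun e => Submodule.subset_span ⟨_, _, .ghost R e⟩)
      (fun a x hx => mul_mem_of_mem_span ?_ hx) (fun e x hx => mul_mem_of_mem_span ?_ hx)
      (fun e x hx => mul_mem_of_mem_span ?_ hx)
    · rintro z ⟨m, n, h⟩
      rcases h.vertex_mul a with h' | h' <;> rw [h']
      · exact zero_mem _
      · exact Submodule.subset_span ⟨m, n, h⟩
    · rintro z ⟨m, n, h⟩
      exact Submodule.subset_span ⟨_, _, h.edge_mul e⟩
    · rintro z ⟨m, n, h⟩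
      rcases m with _ | m
      · rcases h.ghost_mul_of_zero e with h | h
        · rw [h]; exact zero_mem _
        · exact Submodule.subset_span ⟨_, _, h⟩
      · rcases h.ghost_mul_of_succ e with h | h
        · rw [h]; exact zero_mem _
        · exact Submodule.subset_span ⟨_, _, h⟩
  rw [eq_top_iff, ← hspan, Submodule.span_le]
  rintro z ⟨m, n, h⟩
  exact Submodule.mem_iSup_of_mem _ (h.mem_monomialSpan rfl)

theorem diagonalSpan_mono : Monotone (diagonalSpan R E) := fun _ _ hkl =>
  Submodule.span_mono fun _ ⟨n, hn, h⟩ => ⟨n, hn.trans hkl, h⟩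

theorem exists_mem_diagonalSpan {x : LeavittPathAlgebra R E} (hx : x ∈ monomialSpan R E 0) :
    ∃ k, x ∈ diagonalSpan R E k := by
  rw [← Submodule.mem_iSup_of_directed _ diagonalSpan_mono.directed_le]
  refine Submodule.span_le.2 ?_ hx
  rintro z ⟨m, n, h0, h⟩
  obtain rfl : m = n := by omega
  exact Submodule.mem_iSup_of_mem m (Submodule.subset_span ⟨m, le_rfl, h⟩)

/-- Each side cancels one factor of a monomial of positive length, and a vertex yields `0` or a
vertex. This is the descent in the uniqueness theorem. -/
theorem ghost_mul_mul_edge_mem {k : ℕ} {x : LeavittPathAlgebra R E}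
    (hx : x ∈ diagonalSpan R E (k + 1)) (e f : E.Edge) :
    ghost R e * x * edge R f ∈ diagonalSpan R E k := by
  rw [mul_assoc]
  refine mul_mem_of_mem_span (s := {z | ∃ y ∈ {z | ∃ n ≤ k + 1, IsMonomial R E n n z},
    z = y * edge R f}) ?_ (mem_mul_of_mem_span (fun z hz => Submodule.subset_span ⟨z, hz, rfl⟩) hx)
  rintro _ ⟨z, ⟨n, hn, h⟩, rfl⟩
  rw [← mul_assoc]
  rcases n with _ | n
  · rcases h.ghost_mul_of_zero e with h | h
    · rw [h, zero_mul]; exact zero_mem _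
    · rcases h.mul_edge_of_succ f with h | h
      · rw [h]; exact zero_mem _
      · exact Submodule.subset_span ⟨_, Nat.zero_le k, h⟩
  · rcases h.ghost_mul_of_succ e with h | h
    · rw [h, zero_mul]; exact zero_mem _
    · rcases h.mul_edge_of_succ f with h | h
      · rw [h]; exact zero_mem _
      · exact Submodule.subset_span ⟨n, by omega, h⟩

/-! ### Sums of the projections `e e*` -/

variable (R) in
/-- The sum of the projections `e e*` over a finite set of edges. -/
noncomputable def edgeProj (F : Finset E.Edge) : LeavittPathAlgebra R E :=
  ∑ e ∈ F, edge R e * ghost R e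

theorem edgeProj_mul_edge {F : Finset E.Edge} {e : E.Edge} (he : e ∈ F) :
    edgeProj R F * edge R e = edge R e := by
  rw [edgeProj, Finset.sum_mul, Finset.sum_eq_single_of_mem e he]
  · rw [mul_assoc, ghost_mul_edge, edge_mul_vertex]
  · intro f _ hf
    rw [mul_assoc, ghost_mul_edge_of_ne hf, mul_zero]

theorem ghost_mul_edgeProj {F : Finset E.Edge} {e : E.Edge} (he : e ∈ F) :
    ghost R e * edgeProj R F = ghost R e := by
  rw [edgeProj, Finset.mul_sum, Finset.sum_eq_single_of_mem e he]
  · rw [← mul_assoc, ghost_mul_edge, vertex_mul_ghost]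
  · intro f _ hf
    rw [← mul_assoc, ghost_mul_edge_of_ne hf.symm, zero_mul]

theorem ghost_mul_edgeProj_of_notMem {F : Finset E.Edge} {e : E.Edge} (he : e ∉ F) :
    ghost R e * edgeProj R F = 0 := by
  rw [edgeProj, Finset.mul_sum]
  refine Finset.sum_eq_zero fun f hf => ?_
  have hef : e ≠ f := fun h => he (h ▸ hf)
  rw [← mul_assoc, ghost_mul_edge_of_ne hef, zero_mul]

theorem edgeProj_mul_edgeProj {F T : Finset E.Edge} (h : T ⊆ F) :
    edgeProj R T * edgeProj R F = edgeProj R T := by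
  nth_rewrite 1 [edgeProj]
  rw [Finset.sum_mul]
  refine Finset.sum_congr rfl fun e he => ?_
  rw [mul_assoc, ghost_mul_edgeProj (h he)]

theorem eq_zero_of_vertex_mul {x : LeavittPathAlgebra R E} (h : ∀ a, vertex R a * x = 0) :
    x = 0 := by
  obtain ⟨T, hT⟩ := exists_local_unit R x
  rw [← hT T subset_rfl, Finset.sum_mul]
  exact Finset.sum_eq_zero fun a _ => h a

/-- If the elements `e* x f` all vanish, where `x = z + y` with `z` diagonal and `y` supported on
finitely many projections `e e*`, then `y` is a combination of these projections. -/
theorem vertex_mul_eq_of_ghost_mul_mul_edge {y z : LeavittPathAlgebra R E} {c : E.Vertex → R}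
    {F : Finset E.Edge} (hz : ∀ b, vertex R b * z = c b • vertex R b)
    (hl : edgeProj R F * y = y) (hr : y * edgeProj R F = y)
    (h : ∀ e f, ghost R e * (z + y) * edge R f = 0) (a : E.Vertex) :
    vertex R a * y = -(c a • (vertex R a * edgeProj R F)) := by
  have hgz : ∀ e, ghost R e * z = c (E.s e) • ghost R e := by
    intro e
    rw [← ghost_mul_vertex, mul_assoc, hz, mul_smul_comm]
  have hgy : ∀ e ∈ F, ghost R e * y = -(c (E.s e) • ghost R e) := by
    intro e he
    -- With `P = edgeProj R F`, these identities recover `e* y = e* y P = ∑ (e* y f) f* = -c (e* P)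
    -- = -c e*`.
    have h1 : ∀ f, ghost R e * y * edge R f = -(c (E.s e) • (ghost R e * edge R f)) := by
      intro f
      have := h e f
      rw [mul_add, add_mul, hgz, smul_mul_assoc] at this
      exact eq_neg_of_add_eq_zero_right this
    rw [← hr, ← mul_assoc, ← ghost_mul_edgeProj he]
    simp only [edgeProj, Finset.mul_sum, Finset.smul_sum, ← Finset.sum_neg_distrib]
    refine Finset.sum_congr rfl fun f _ => ?_
    -- The rewriting above has also expanded the left factor `e* = e* P`; this collapses it again.
    have h2 : ghost R e * edgeProj R F * y = ghost R e * y := by rw [mul_assoc, hl]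
    rw [edgeProj, Finset.mul_sum] at h2
    rw [h2, ← mul_assoc, h1, neg_mul, smul_mul_assoc, mul_assoc]
  rw [← hl]
  simp only [edgeProj, Finset.mul_sum, Finset.sum_mul, Finset.smul_sum, ← Finset.sum_neg_distrib]
  refine Finset.sum_congr rfl fun e he => ?_
  rw [mul_assoc, hgy e he, mul_neg, mul_neg, mul_smul_comm, mul_smul_comm]
  by_cases hae : a = E.s e
  · rw [hae]
  · rw [← mul_assoc, vertex_mul_edge_of_ne hae, zero_mul, smul_zero, smul_zero]

/-- An element of degree `0` is a diagonal element plus an element supported on finitely many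
projections `e e*`. -/
theorem exists_decomposition {k : ℕ} {x : LeavittPathAlgebra R E} (hx : x ∈ diagonalSpan R E k) :
    ∃ (c : E.Vertex → R) (F : Finset E.Edge) (y z : LeavittPathAlgebra R E), x = z + y ∧
      (∀ b, vertex R b * z = c b • vertex R b) ∧
      ∀ F', F ⊆ F' → edgeProj R F' * y = y ∧ y * edgeProj R F' = y := by
  classical
  induction hx using Submodule.span_induction with
  | mem x h =>
    obtain ⟨n, -, h⟩ := h
    rcases n with _ | n
    · generalize h0 : 0 = m, h1 : 0 = n at h
      obtain ⟨a⟩ | _ | _ := h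
      · refine ⟨Pi.single a 1, ∅, 0, vertex R a, (add_zero _).symm, fun b => ?_, by simp⟩
        by_cases hab : b = a
        · subst hab
          rw [vertex_mul_self, Pi.single_eq_same, one_smul]
        · rw [vertex_mul_vertex R hab, Pi.single_eq_of_ne hab, zero_smul]
      · omega
      · omega
    · obtain ⟨e, y, hy, he⟩ := h.exists_edge_mul
      obtain ⟨f, t, ht, hf⟩ := h.exists_mul_ghost
      refine ⟨0, {e, f}, x, 0, (zero_add _).symm, by simp, fun F' hF' => ⟨?_, ?_⟩⟩
      · rw [he, ← mul_assoc, edgeProj_mul_edge (hF' (by simp))]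
      · rw [hf, mul_assoc, ghost_mul_edgeProj (hF' (by simp))]
  | zero => exact ⟨0, ∅, 0, 0, by simp, by simp, by simp⟩
  | add x₁ x₂ _ _ h₁ h₂ =>
    obtain ⟨c₁, F₁, y₁, z₁, rfl, hz₁, hy₁⟩ := h₁
    obtain ⟨c₂, F₂, y₂, z₂, rfl, hz₂, hy₂⟩ := h₂
    refine ⟨c₁ + c₂, F₁ ∪ F₂, y₁ + y₂, z₁ + z₂, add_add_add_comm _ _ _ _, fun b => ?_,
      fun F' hF' => ?_⟩
    · rw [mul_add, hz₁, hz₂, Pi.add_apply, add_smul]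
    · have h₁ := hy₁ F' (Finset.union_subset_left hF')
      have h₂ := hy₂ F' (Finset.union_subset_right hF')
      rw [mul_add, add_mul, h₁.1, h₁.2, h₂.1, h₂.2]
      exact ⟨rfl, rfl⟩
  | smul d x _ h =>
    obtain ⟨c, F, y, z, rfl, hz, hy⟩ := h
    refine ⟨d • c, F, d • y, d • z, smul_add _ _ _, fun b => ?_, fun F' hF' => ?_⟩
    · rw [mul_smul_comm, hz, Pi.smul_apply, smul_assoc]
    · rw [mul_smul_comm, smul_mul_assoc, (hy F' hF').1, (hy F' hF').2]
      exact ⟨rfl, rfl⟩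

theorem exists_diagonal_of_mem_diagonalSpan_zero {x : LeavittPathAlgebra R E}
    (hx : x ∈ diagonalSpan R E 0) : ∀ b, ∃ c : R, vertex R b * x = c • vertex R b := by
  intro b
  have : vertex R b * x ∈ Submodule.span R {vertex R b} := by
    refine mul_mem_of_mem_span ?_ hx
    rintro z ⟨n, hn, h⟩
    obtain rfl : n = 0 := by omega
    generalize h0 : 0 = m, h1 : 0 = n at h
    obtain ⟨a⟩ | _ | _ := h
    · by_cases hab : b = a
      · rw [← hab, vertex_mul_self]
        exact Submodule.mem_span_singleton_self _
      · rw [vertex_mul_vertex R hab]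
        exact zero_mem _
    · omega
    · omega
  obtain ⟨c, hc⟩ := Submodule.mem_span_singleton.1 this
  exact ⟨c, hc.symm⟩

/-! ### The graded uniqueness theorem -/

section GradedUniqueness

variable {K : TwoSidedIdeal (LeavittPathAlgebra R E)}

/-- By induction all `e* x f` vanish, so `a x = c (a - a P)` for every vertex `a`, where `P` is any
sufficiently large finite sum of projections `e e*`. The three kinds of vertex then need different
arguments. -/
theorem eq_zero_of_mem_diagonalSpan (hK : ∀ a (c : R), c • vertex R a ∈ K → c = 0) (k : ℕ)
    {x : LeavittPathAlgebra R E} (hx : x ∈ diagonalSpan R E k) (hxK : x ∈ K) : x = 0 := by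
  classical
  induction k generalizing x with
  | zero =>
    refine eq_zero_of_vertex_mul fun a => ?_
    obtain ⟨c, hc⟩ := exists_diagonal_of_mem_diagonalSpan_zero hx a
    rw [hc, hK a c (hc ▸ K.mul_mem_left _ _ hxK), zero_smul]
  | succ k ih =>
    have h0 : ∀ e f, ghost R e * x * edge R f = 0 := fun e f =>
      ih (ghost_mul_mul_edge_mem hx e f) (K.mul_mem_right _ _ (K.mul_mem_left _ _ hxK))
    obtain ⟨c, F, y, z, rfl, hz, hy⟩ := exists_decomposition hx
    have key : ∀ a F', F ⊆ F' → vertex R a * (z + y) =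
        c a • (vertex R a - vertex R a * edgeProj R F') := by
      intro a F' hF'
      rw [mul_add, hz, vertex_mul_eq_of_ghost_mul_mul_edge hz (hy F' hF').1 (hy F' hF').2 h0,
        smul_sub, sub_eq_add_neg]
    refine eq_zero_of_vertex_mul fun a => ?_
    by_cases hfin : {e : E.Edge | E.s e = a}.Finite
    · by_cases hne : {e : E.Edge | E.s e = a}.Nonempty
      · have ha : E.IsRegular a := ⟨hne, hfin⟩
        have hP : vertex R a = edgeProj R ha.2.toFinset := vertex_eq_sum R a ha
        -- At a regular vertex, `P` may be enlarged to include all edges leaving `a`, and then `a P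
        -- = a`.
        rw [key a (F ∪ ha.2.toFinset) Finset.subset_union_left, hP,
          edgeProj_mul_edgeProj Finset.subset_union_right, sub_self, smul_zero]
      -- At a sink, `a P = 0`, so `a x` is a multiple of a vertex that lies in `K`.
      · have hP : vertex R a * edgeProj R F = 0 := by
          rw [edgeProj, Finset.mul_sum]
          refine Finset.sum_eq_zero fun e _ => ?_
          rw [← mul_assoc, vertex_mul_edge_of_ne (fun h => hne ⟨e, h.symm⟩), zero_mul]
        have h := key a F subset_rfl
        rw [hP, sub_zero] at h
        rw [h, hK a (c a) (h ▸ K.mul_mem_left _ _ hxK), zero_smul]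
    -- At an infinite emitter some edge `e` is not used by `P`. Then `0 = e* x e = c r(e)`, and
    -- since `0 ∈ K` the hypothesis on `K` gives `c = 0`.
    · obtain ⟨e, he, heF⟩ := Set.Infinite.exists_notMem_finset hfin F
      obtain rfl : E.s e = a := he
      have h := h0 e e
      have h1 : ghost R e * (z + y) = c (E.s e) • ghost R e := by
        rw [← ghost_mul_vertex, mul_assoc, key _ F subset_rfl, mul_smul_comm, mul_sub, ← mul_assoc,
          ghost_mul_vertex, ghost_mul_edgeProj_of_notMem heF, sub_zero]
      rw [h1, smul_mul_assoc, ghost_mul_edge] at h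
      rw [key _ F subset_rfl, hK (E.r e) (c (E.s e)) (h ▸ K.zero_mem), zero_smul]

/-- A monomial of positive degree begins with an edge. Allowing every larger `F'` lets the sets for
different summands be merged. -/
theorem exists_edgeProj_mul {d : ℕ} {x : LeavittPathAlgebra R E}
    (hx : x ∈ monomialSpan R E (d + 1)) :
    ∃ F : Finset E.Edge, ∀ F', F ⊆ F' → edgeProj R F' * x = x := by
  classical
  induction hx using Submodule.span_induction with
  | mem x h =>
    obtain ⟨m, n, hmn, h⟩ := h
    obtain ⟨m, rfl⟩ : ∃ k, m = k + 1 := ⟨m - 1, by omega⟩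
    obtain ⟨e, y, hy, rfl⟩ := h.exists_edge_mul
    refine ⟨{e}, fun F' hF' => ?_⟩
    rw [← mul_assoc, edgeProj_mul_edge (hF' (by simp))]
  | zero => exact ⟨∅, by simp⟩
  | add x₁ x₂ _ _ h₁ h₂ =>
    obtain ⟨F₁, h₁⟩ := h₁
    obtain ⟨F₂, h₂⟩ := h₂
    refine ⟨F₁ ∪ F₂, fun F' hF' => ?_⟩
    rw [mul_add, h₁ F' (Finset.union_subset_left hF'), h₂ F' (Finset.union_subset_right hF')]
  | smul c x _ h =>
    obtain ⟨F, h⟩ := h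
    exact ⟨F, fun F' hF' => by rw [mul_smul_comm, h F' hF']⟩

theorem exists_mul_edgeProj {d : ℕ} {x : LeavittPathAlgebra R E}
    (hx : x ∈ monomialSpan R E (-(d + 1))) :
    ∃ F : Finset E.Edge, ∀ F', F ⊆ F' → x * edgeProj R F' = x := by
  classical
  induction hx using Submodule.span_induction with
  | mem x h =>
    obtain ⟨m, n, hmn, h⟩ := h
    obtain ⟨n, rfl⟩ : ∃ k, n = k + 1 := ⟨n - 1, by omega⟩
    obtain ⟨e, y, hy, rfl⟩ := h.exists_mul_ghost
    refine ⟨{e}, fun F' hF' => ?_⟩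
    rw [mul_assoc, ghost_mul_edgeProj (hF' (by simp))]
  | zero => exact ⟨∅, by simp⟩
  | add x₁ x₂ _ _ h₁ h₂ =>
    obtain ⟨F₁, h₁⟩ := h₁
    obtain ⟨F₂, h₂⟩ := h₂
    refine ⟨F₁ ∪ F₂, fun F' hF' => ?_⟩
    rw [add_mul, h₁ F' (Finset.union_subset_left hF'), h₂ F' (Finset.union_subset_right hF')]
  | smul c x _ h =>
    obtain ⟨F, h⟩ := h
    exact ⟨F, fun F' hF' => by rw [smul_mul_assoc, h F' hF']⟩

/-- An ideal that contains no nonzero multiple of a vertex contains no nonzero homogeneous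
element. -/
theorem eq_zero_of_mem_monomialSpan (hK : ∀ a (c : R), c • vertex R a ∈ K → c = 0) {d : ℤ}
    {x : LeavittPathAlgebra R E} (hx : x ∈ monomialSpan R E d) (hxK : x ∈ K) : x = 0 := by
  have hzero : ∀ x ∈ monomialSpan R E 0, x ∈ K → x = 0 := fun x hx hxK =>
    let ⟨k, hk⟩ := exists_mem_diagonalSpan hx
    eq_zero_of_mem_diagonalSpan hK k hk hxK
  obtain ⟨d, rfl | rfl⟩ := d.eq_nat_or_neg
  · induction d generalizing x with
    | zero => exact hzero x hx hxK
    | succ d ih =>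
      rw [Nat.cast_succ] at hx
      obtain ⟨F, hF⟩ := exists_edgeProj_mul hx
      -- Now `x = ∑ e (e* x)`, and each `e* x` lies in `K` and has degree one less.
      rw [← hF F subset_rfl, edgeProj, Finset.sum_mul]
      refine Finset.sum_eq_zero fun e _ => ?_
      have hm := ghost_mul_mem_monomialSpan hx e
      rw [add_sub_cancel_right] at hm
      have h0 : ghost R e * x = 0 := ih (K.mul_mem_left _ _ hxK) hm
      rw [mul_assoc, h0, mul_zero]
  · induction d generalizing x with
    | zero => exact hzero x (by simpa using hx) hxK
    | succ d ih =>
      rw [Nat.cast_succ] at hx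
      obtain ⟨F, hF⟩ := exists_mul_edgeProj hx
      rw [← hF F subset_rfl, edgeProj, Finset.mul_sum]
      refine Finset.sum_eq_zero fun e _ => ?_
      have hm := mul_edge_mem_monomialSpan hx e
      rw [neg_add, neg_add_cancel_right] at hm
      have h0 : x * edge R e = 0 := ih (K.mul_mem_right _ _ hxK) hm
      rw [← mul_assoc, h0, zero_mul]

end GradedUniqueness

end LeavittPathAlgebra

namespace LeavittPathAlgebra

variable {R : Type w} [CommRing R] {E : DirectedGraph.{u, v}}

/-! ### The quotient family in `L_R(E)` -/

section Quotient

variable (p : E.AdmissiblePair)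

open Classical in
variable (R) in
/-- The idempotent of `L_R(E)` that corresponds to the vertex `a` of the quotient graph: it is
`∑ e e*`, over the edges `e` from `a` to vertices outside `H`, if `a ∈ B_H \ S`, and `a`
otherwise. -/
noncomputable def mainVertex (a : E.Vertex) : LeavittPathAlgebra R E :=
  if h : a ∈ E.breakingVertices p.H \ p.S then edgeProj R h.1.2.2.2.toFinset else vertex R a

variable {p}

theorem mainVertex_of_mem {a : E.Vertex} (h : a ∈ E.breakingVertices p.H \ p.S) :
    mainVertex R p a = edgeProj R h.1.2.2.2.toFinset := dif_pos h

theorem mainVertex_of_notMem {a : E.Vertex} (h : a ∉ E.breakingVertices p.H \ p.S) :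
    mainVertex R p a = vertex R a := dif_neg h

theorem vertex_mul_edgeProj {a : E.Vertex} {F : Finset E.Edge} (hF : ∀ e ∈ F, E.s e = a) :
    vertex R a * edgeProj R F = edgeProj R F := by
  rw [edgeProj, Finset.mul_sum]
  refine Finset.sum_congr rfl fun e he => ?_
  rw [← hF e he, ← mul_assoc, vertex_mul_edge]

theorem edgeProj_mul_vertex {a : E.Vertex} {F : Finset E.Edge} (hF : ∀ e ∈ F, E.s e = a) :
    edgeProj R F * vertex R a = edgeProj R F := by
  rw [edgeProj, Finset.sum_mul]
  refine Finset.sum_congr rfl fun e he => ?_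
  rw [← hF e he, mul_assoc, ghost_mul_vertex]

theorem vertex_mul_mainVertex (a : E.Vertex) :
    vertex R a * mainVertex R p a = mainVertex R p a := by
  by_cases h : a ∈ E.breakingVertices p.H \ p.S
  · rw [mainVertex_of_mem h, vertex_mul_edgeProj]
    intro e he
    exact ((Set.Finite.mem_toFinset _).1 he).1
  · rw [mainVertex_of_notMem h, vertex_mul_self]

theorem mainVertex_mul_vertex (a : E.Vertex) :
    mainVertex R p a * vertex R a = mainVertex R p a := by
  by_cases h : a ∈ E.breakingVertices p.H \ p.S
  · rw [mainVertex_of_mem h, edgeProj_mul_vertex]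
    intro e he
    exact ((Set.Finite.mem_toFinset _).1 he).1
  · rw [mainVertex_of_notMem h, vertex_mul_self]

theorem mainVertex_mul_self (a : E.Vertex) :
    mainVertex R p a * mainVertex R p a = mainVertex R p a := by
  by_cases h : a ∈ E.breakingVertices p.H \ p.S
  · rw [mainVertex_of_mem h, edgeProj_mul_edgeProj subset_rfl]
  · rw [mainVertex_of_notMem h, vertex_mul_self]

theorem mainVertex_mul_edge {e : E.Edge} (he : E.r e ∉ p.H) :
    mainVertex R p (E.s e) * edge R e = edge R e := by
  by_cases h : E.s e ∈ E.breakingVertices p.H \ p.S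
  · rw [mainVertex_of_mem h, edgeProj_mul_edge]
    exact (Set.Finite.mem_toFinset _).2 ⟨rfl, he⟩
  · rw [mainVertex_of_notMem h, vertex_mul_edge]

theorem ghost_mul_mainVertex {e : E.Edge} (he : E.r e ∉ p.H) :
    ghost R e * mainVertex R p (E.s e) = ghost R e := by
  by_cases h : E.s e ∈ E.breakingVertices p.H \ p.S
  · rw [mainVertex_of_mem h, ghost_mul_edgeProj]
    exact (Set.Finite.mem_toFinset _).2 ⟨rfl, he⟩
  · rw [mainVertex_of_notMem h, ghost_mul_vertex]

variable (p) in
/-- The vertex of `E` underlying a vertex of the quotient graph. -/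
def baseVertex : p.quotientGraph.Vertex → E.Vertex := Sum.elim (fun a => a.1) (fun a => a.1)

variable (p) in
/-- The edge of `E` underlying an edge of the quotient graph. -/
def baseEdge : p.quotientGraph.Edge → E.Edge := Sum.elim (fun e => e.1) (fun e => e.1)

variable (R p) in
/-- The idempotent of `L_R(E)` that corresponds to a vertex of the quotient graph. -/
noncomputable def quotientVertex : p.quotientGraph.Vertex → LeavittPathAlgebra R E :=
  Sum.elim (fun a => mainVertex R p a.1) (fun a => vertex R a.1 - mainVertex R p a.1)

theorem baseVertex_r (e : p.quotientGraph.Edge) :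
    baseVertex p (p.quotientGraph.r e) = E.r (baseEdge p e) := by
  rcases e with e | e <;> rfl

theorem vertex_mul_quotientVertex (x : p.quotientGraph.Vertex) :
    vertex R (baseVertex p x) * quotientVertex R p x = quotientVertex R p x := by
  rcases x with a | a
  · exact vertex_mul_mainVertex a.1
  · change vertex R a.1 * (vertex R a.1 - mainVertex R p a.1) = vertex R a.1 - mainVertex R p a.1
    rw [mul_sub, vertex_mul_self, vertex_mul_mainVertex]

theorem quotientVertex_mul_vertex (x : p.quotientGraph.Vertex) :
    quotientVertex R p x * vertex R (baseVertex p x) = quotientVertex R p x := by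
  rcases x with a | a
  · exact mainVertex_mul_vertex a.1
  · change (vertex R a.1 - mainVertex R p a.1) * vertex R a.1 = vertex R a.1 - mainVertex R p a.1
    rw [sub_mul, vertex_mul_self, mainVertex_mul_vertex]

theorem quotientVertex_mul_self (x : p.quotientGraph.Vertex) :
    quotientVertex R p x * quotientVertex R p x = quotientVertex R p x := by
  rcases x with a | a
  · exact mainVertex_mul_self a.1
  · change (vertex R a.1 - mainVertex R p a.1) * (vertex R a.1 - mainVertex R p a.1) =
      vertex R a.1 - mainVertex R p a.1
    rw [sub_mul, mul_sub, mul_sub, vertex_mul_self, mainVertex_mul_vertex, vertex_mul_mainVertex,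
      mainVertex_mul_self, sub_self, sub_zero]

theorem quotientVertex_mul_quotientVertex {x y : p.quotientGraph.Vertex} (hxy : x ≠ y) :
    quotientVertex R p x * quotientVertex R p y = 0 := by
  by_cases h : baseVertex p x = baseVertex p y
  · rcases x with a | a <;> rcases y with b | b
    · exact absurd (congrArg Sum.inl (Subtype.ext h)) hxy
    · obtain ⟨a, ha⟩ := a
      obtain ⟨b, hb⟩ := b
      obtain rfl : a = b := h
      change mainVertex R p a * (vertex R a - mainVertex R p a) = 0
      rw [mul_sub, mainVertex_mul_vertex, mainVertex_mul_self, sub_self]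
    · obtain ⟨a, ha⟩ := a
      obtain ⟨b, hb⟩ := b
      obtain rfl : a = b := h
      change (vertex R a - mainVertex R p a) * mainVertex R p a = 0
      rw [sub_mul, vertex_mul_mainVertex, mainVertex_mul_self, sub_self]
    · exact absurd (congrArg Sum.inr (Subtype.ext h)) hxy
  · rw [← quotientVertex_mul_vertex x, ← vertex_mul_quotientVertex y, mul_assoc,
      ← mul_assoc (vertex R _), vertex_mul_vertex R h, zero_mul, mul_zero]

/-- Both `e` and `e'` start at an unprimed vertex. In both cases `r(e) ∉ H`, so if the idempotent of
the source is a sum of projections, `e e*` is among them. -/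
theorem quotientVertex_mul_edge (e : p.quotientGraph.Edge) :
    quotientVertex R p (p.quotientGraph.s e) * edge R (baseEdge p e) = edge R (baseEdge p e) := by
  rcases e with e | e
  · exact mainVertex_mul_edge e.2
  · exact mainVertex_mul_edge e.2.1.1

theorem ghost_mul_quotientVertex (e : p.quotientGraph.Edge) :
    ghost R (baseEdge p e) * quotientVertex R p (p.quotientGraph.s e) =
      ghost R (baseEdge p e) := by
  rcases e with e | e
  · exact ghost_mul_mainVertex e.2
  · exact ghost_mul_mainVertex e.2.1.1

theorem quotientVertex_mul_ghost_mul_edge (e : p.quotientGraph.Edge) :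
    quotientVertex R p (p.quotientGraph.r e) * ghost R (baseEdge p e) *
      (edge R (baseEdge p e) * quotientVertex R p (p.quotientGraph.r e)) =
        quotientVertex R p (p.quotientGraph.r e) := by
  rw [mul_assoc, ← mul_assoc (ghost R _), ghost_mul_edge, ← baseVertex_r,
    vertex_mul_quotientVertex, quotientVertex_mul_self]

/-- Distinct edges over the same edge of `E` are `e` and `e'`. What separates them is the
orthogonality of the idempotents of their ranges. -/
theorem quotientVertex_mul_ghost_mul_edge_of_ne {e f : p.quotientGraph.Edge} (hef : e ≠ f) :
    quotientVertex R p (p.quotientGraph.r e) * ghost R (baseEdge p e) *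
      (edge R (baseEdge p f) * quotientVertex R p (p.quotientGraph.r f)) = 0 := by
  by_cases h : baseEdge p e = baseEdge p f
  · rw [h, mul_assoc, ← mul_assoc (ghost R _), ghost_mul_edge, ← baseVertex_r,
      vertex_mul_quotientVertex, quotientVertex_mul_quotientVertex]
    intro hr
    rcases e with e | e <;> rcases f with f | f
    · exact hef (congrArg Sum.inl (Subtype.ext h))
    · cases hr
    · cases hr
    · exact hef (congrArg Sum.inr (Subtype.ext h))
  · rw [mul_assoc, ← mul_assoc (ghost R _), ghost_mul_edge_of_ne h, zero_mul, mul_zero]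

/-- The sum of the projections of the edges of the quotient graph that start at an old vertex. -/
theorem sum_quotient_edges {a : {a : E.Vertex // a ∉ p.H}}
    {T : Finset p.quotientGraph.Edge} {F : Finset E.Edge}
    (hT : ∀ e, e ∈ T ↔ p.quotientGraph.s e = Sum.inl a)
    (hF : ∀ e, e ∈ F ↔ E.s e = a.1 ∧ E.r e ∉ p.H) :
    ∑ e ∈ T, edge R (baseEdge p e) * quotientVertex R p (p.quotientGraph.r e) *
      (quotientVertex R p (p.quotientGraph.r e) * ghost R (baseEdge p e)) = edgeProj R F := by
  classical
  have hsum : ∀ e ∈ T, edge R (baseEdge p e) * quotientVertex R p (p.quotientGraph.r e) *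
      (quotientVertex R p (p.quotientGraph.r e) * ghost R (baseEdge p e)) =
      edge R (baseEdge p e) * quotientVertex R p (p.quotientGraph.r e) *
        ghost R (baseEdge p e) := by
    intro e _
    rw [mul_assoc, ← mul_assoc (quotientVertex R p _), quotientVertex_mul_self, ← mul_assoc]
  rw [Finset.sum_congr rfl hsum]
  -- Contributions of `e` and of `e'`, written for all edges of `E`; their sum is `e e*`.
  let g₁ : E.Edge → LeavittPathAlgebra R E :=
    fun e => edge R e * mainVertex R p (E.r e) * ghost R e
  let g₂ : E.Edge → LeavittPathAlgebra R E :=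
    fun e => edge R e * (vertex R (E.r e) - mainVertex R p (E.r e)) * ghost R e
  let T' : Finset ({e : E.Edge // E.r e ∉ p.H} ⊕
    {e : E.Edge // E.r e ∈ E.breakingVertices p.H \ p.S}) := T
  have hl : ∀ e : {e : E.Edge // E.r e ∉ p.H}, e ∈ T'.toLeft ↔ E.s e.1 = a.1 := by
    intro e
    rw [Finset.mem_toLeft]
    exact (hT (Sum.inl e)).trans (Sum.inl_injective.eq_iff.trans Subtype.ext_iff)
  have hr : ∀ e : {e : E.Edge // E.r e ∈ E.breakingVertices p.H \ p.S},
      e ∈ T'.toRight ↔ E.s e.1 = a.1 := by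
    intro e
    rw [Finset.mem_toRight]
    exact (hT (Sum.inr e)).trans (Sum.inl_injective.eq_iff.trans Subtype.ext_iff)
  have h₁ : ∑ e ∈ T'.toLeft, g₁ e.1 = ∑ e ∈ F, g₁ e := by
    have : F = T'.toLeft.map (Function.Embedding.subtype _) := by
      ext e
      simp only [hF, Finset.mem_map, hl, Function.Embedding.coe_subtype, Subtype.exists]
      exact ⟨fun h => ⟨e, h.2, h.1, rfl⟩, fun ⟨f, hf, hs, hfe⟩ => hfe ▸ ⟨hs, hf⟩⟩
    rw [this, Finset.sum_map]
    rfl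
  -- An edge without a primed copy contributes zero to `g₂`, so the sum may be extended to all of
  -- `F`.
  have h₂ : ∑ e ∈ T'.toRight, g₂ e.1 = ∑ e ∈ F, g₂ e := by
    have : ∑ e ∈ T'.toRight, g₂ e.1 =
        ∑ e ∈ T'.toRight.map (Function.Embedding.subtype _), g₂ e := by
      rw [Finset.sum_map]
      rfl
    rw [this]
    refine Finset.sum_subset ?_ ?_
    · intro e he
      simp only [Finset.mem_map, hr, Function.Embedding.coe_subtype, Subtype.exists] at he
      obtain ⟨f, hf, hs, rfl⟩ := he
      exact (hF f).2 ⟨hs, hf.1.1⟩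
    · intro e he heT
      have hb : E.r e ∉ E.breakingVertices p.H \ p.S := fun hb =>
        heT (Finset.mem_map.2 ⟨⟨e, hb⟩, (hr _).2 ((hF e).1 he).1, rfl⟩)
      simp only [g₂]
      rw [mainVertex_of_notMem hb, sub_self, mul_zero, zero_mul]
  calc _ = ∑ e ∈ T'.toLeft.disjSum T'.toRight, edge R (baseEdge p e) *
          quotientVertex R p (p.quotientGraph.r e) * ghost R (baseEdge p e) := by
        rw [Finset.toLeft_disjSum_toRight]
        rfl
    _ = ∑ e ∈ T'.toLeft, g₁ e.1 + ∑ e ∈ T'.toRight, g₂ e.1 := Finset.sum_disjSum _ _ _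
    _ = edgeProj R F := by
        rw [h₁, h₂, ← Finset.sum_add_distrib, edgeProj]
        refine Finset.sum_congr rfl fun e _ => ?_
        simp only [g₁, g₂]
        rw [← add_mul, ← mul_add, add_sub_cancel, edge_mul_vertex]

end Quotient

/-! ### The quotient algebra -/

section QuotientAlgebra

variable (A : TwoSidedIdeal (LeavittPathAlgebra R E))

/-- The projection of `L_R(E)` onto `L_R(E) / A`. -/
noncomputable def quotientMap : LeavittPathAlgebra R E →ₙₐ[R] QuotientAlgebra A where
  toFun x := (x : A.ringCon.Quotient)
  map_smul' _ _ := rfl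
  map_zero' := rfl
  map_add' _ _ := rfl
  map_mul' _ _ := rfl

theorem quotientMap_surjective : Function.Surjective (quotientMap A) := Quotient.mk''_surjective

variable {A}

theorem quotientMap_eq_zero {x : LeavittPathAlgebra R E} : quotientMap A x = 0 ↔ x ∈ A := by
  rw [TwoSidedIdeal.mem_iff]
  exact RingCon.eq A.ringCon

theorem quotientMap_eq {x y : LeavittPathAlgebra R E} :
    quotientMap A x = quotientMap A y ↔ x - y ∈ A := by
  rw [← quotientMap_eq_zero, map_sub, sub_eq_zero]

theorem edge_mem_of_range_mem {e : E.Edge} (h : vertex R (E.r e) ∈ A) : edge R e ∈ A := by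
  rw [← edge_mul_vertex]
  exact A.mul_mem_left _ _ h

theorem ghost_mem_of_range_mem {e : E.Edge} (h : vertex R (E.r e) ∈ A) : ghost R e ∈ A := by
  rw [← vertex_mul_ghost]
  exact A.mul_mem_right _ _ h

/-- For `a ∈ B_H \ S` the difference is zero, and for `a ∈ S` it is `a^H ∈ A`. If `a` is not
breaking, then `F` being finite and nonempty forces `a` to be regular, and the summands of `a`
outside `F` have range in `H`. -/
theorem mainVertex_sub_edgeProj_mem {a : E.Vertex} {F : Finset E.Edge} (hne : F.Nonempty)
    (hF : ∀ e, e ∈ F ↔ E.s e = a ∧ E.r e ∉ (idealPair A).H) :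
    mainVertex R (idealPair A) a - edgeProj R F ∈ A := by
  classical
  have hset : {e : E.Edge | E.s e = a ∧ E.r e ∉ (idealPair A).H} = F :=
    Set.ext fun e => (hF e).symm
  have hFt : ∀ h : {e : E.Edge | E.s e = a ∧ E.r e ∉ (idealPair A).H}.Finite,
      h.toFinset = F := fun h => by
    ext e
    rw [Set.Finite.mem_toFinset]
    exact (hF e).symm
  by_cases hB : a ∈ E.breakingVertices (idealPair A).H
  · by_cases hS : a ∈ (idealPair A).S
    · rw [mainVertex_of_notMem fun h => h.2 hS]
      obtain ⟨ha, hbr⟩ := hS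
      have := hFt ha.2.2.2
      rw [edgeProj, ← this]
      exact hbr
    · rw [mainVertex_of_mem ⟨hB, hS⟩, hFt, sub_self]
      exact A.zero_mem
  · rw [mainVertex_of_notMem fun h => hB h.1]
    obtain ⟨f, hf⟩ := hne
    have hf' := (hF f).1 hf
    have hfin : {e : E.Edge | E.s e = a}.Finite := by
      by_contra hinf
      refine hB ⟨hf'.1 ▸ (idealPair A).source_notMem hf'.2, hinf, ⟨f, hf'⟩, ?_⟩
      rw [hset]
      exact F.finite_toSet
    have ha : E.IsRegular a := ⟨⟨f, hf'.1⟩, hfin⟩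
    have hsub : F ⊆ ha.2.toFinset := fun e he =>
      (Set.Finite.mem_toFinset _).2 ((hF e).1 he).1
    rw [vertex_eq_sum R a ha, edgeProj, ← Finset.sum_sdiff hsub, add_sub_cancel_right]
    refine sum_mem fun e he => A.mul_mem_right _ _ (edge_mem_of_range_mem ?_)
    rw [Finset.mem_sdiff, Set.Finite.mem_toFinset] at he
    by_contra hr
    exact he.2 ((hF e).2 ⟨he.1, hr⟩)

variable (A) in
/-- The family in `L_R(E) / A` that corresponds to the quotient graph. -/
noncomputable def quotientFamily :
    LeavittFamily (idealPair A).quotientGraph (QuotientAlgebra A) where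
  vertex x := quotientMap A (quotientVertex R _ x)
  edge e := quotientMap A (edge R (baseEdge _ e) *
    quotientVertex R _ ((idealPair A).quotientGraph.r e))
  ghost e := quotientMap A (quotientVertex R _ ((idealPair A).quotientGraph.r e) *
    ghost R (baseEdge _ e))
  vertex_mul_self x := by rw [← map_mul, quotientVertex_mul_self]
  vertex_mul_vertex x y h := by rw [← map_mul, quotientVertex_mul_quotientVertex h, map_zero]
  vertex_mul_edge e := by rw [← map_mul, ← mul_assoc, quotientVertex_mul_edge]
  edge_mul_vertex e := by rw [← map_mul, mul_assoc, quotientVertex_mul_self]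
  vertex_mul_ghost e := by rw [← map_mul, ← mul_assoc, quotientVertex_mul_self]
  ghost_mul_vertex e := by rw [← map_mul, mul_assoc, ghost_mul_quotientVertex]
  ghost_mul_edge e := by rw [← map_mul, quotientVertex_mul_ghost_mul_edge]
  ghost_mul_edge_of_ne e f h := by
    rw [← map_mul, quotientVertex_mul_ghost_mul_edge_of_ne h, map_zero]
  vertex_eq_sum x hx := by
    rcases x with a | a
    · have hinj : {e : E.Edge | E.s e = a.1 ∧ E.r e ∉ (idealPair A).H} ⊆
          baseEdge _ '' {e | (idealPair A).quotientGraph.s e = Sum.inl a} := by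
        rintro e ⟨hs, hr⟩
        exact ⟨Sum.inl ⟨e, hr⟩, congrArg Sum.inl (Subtype.ext hs), rfl⟩
      have hfin := (hx.2.image _).subset hinj
      have hF : ∀ e, e ∈ hfin.toFinset ↔ E.s e = a.1 ∧ E.r e ∉ (idealPair A).H :=
        fun e => Set.Finite.mem_toFinset _
      simp only [← map_mul]
      rw [← map_sum, sum_quotient_edges (fun e => Set.Finite.mem_toFinset _) hF, quotientMap_eq]
      refine mainVertex_sub_edgeProj_mem ?_ hF
      obtain ⟨e | e, he⟩ := hx.1
      · exact ⟨e.1, (hF _).2 ⟨congrArg Subtype.val (Sum.inl_injective he), e.2⟩⟩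
      · exact ⟨e.1, (hF _).2 ⟨congrArg Subtype.val (Sum.inl_injective he), e.2.1.1⟩⟩
    -- The new vertices are sinks.
    · obtain ⟨e | e, he⟩ := hx.1 <;> cases he

instance : IsScalarTower R (QuotientAlgebra A) (QuotientAlgebra A) where
  smul_assoc c x y := by
    obtain ⟨x, rfl⟩ := quotientMap_surjective A x
    obtain ⟨y, rfl⟩ := quotientMap_surjective A y
    simp only [smul_eq_mul, ← map_smul, ← map_mul, smul_mul_assoc]

instance : SMulCommClass R (QuotientAlgebra A) (QuotientAlgebra A) where
  smul_comm c x y := by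
    obtain ⟨x, rfl⟩ := quotientMap_surjective A x
    obtain ⟨y, rfl⟩ := quotientMap_surjective A y
    simp only [smul_eq_mul, ← map_smul, ← map_mul, mul_smul_comm]

end QuotientAlgebra

/-! ### Basic graded ideals -/

section Basic

variable {A : TwoSidedIdeal (LeavittPathAlgebra R E)} {I : Ideal R}

theorem IsBasicGraded.mem_of_mem_saturatedFunction (hA : IsBasicGraded A I) {p : E.NontrivialPair}
    {c : R} (hc : c ∈ saturatedFunction A p) (h1 : (1 : R) ∉ saturatedFunction A p) : c ∈ I := by
  have hp : saturatedFunction A p ∈ Set.range (saturatedFunction A) := ⟨p, rfl⟩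
  have hpI : saturatedFunction A p = I := by
    rcases hA.image with h | h <;> rw [h] at hp
    · rcases hp with hp | hp
      · exact hp
      · rw [Set.mem_singleton_iff] at hp
        rw [hp] at h1
        exact absurd trivial h1
    · exact hp
  exact hpI ▸ hc

variable (A) in
/-- The vertices whose multiples by `c` lie in `A`, as an admissible pair. -/
def smulPair (c : R) : E.AdmissiblePair where
  H := {a | c • vertex R a ∈ A}
  S := ∅
  hereditary := by
    rintro a b ha ⟨q⟩
    induction q with
    | nil => exact ha
    | cons q e ih =>
      obtain ⟨e, rfl, rfl⟩ := e
      have h : c • vertex R (E.r e) = ghost R e * (c • vertex R (E.s e)) * edge R e := by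
        rw [mul_smul_comm, ghost_mul_vertex, smul_mul_assoc, ghost_mul_edge]
      change c • vertex R (E.r e) ∈ A
      rw [h]
      exact A.mul_mem_right _ _ (A.mul_mem_left _ _ ih)
  saturated := by
    intro a ha h
    change c • vertex R a ∈ A
    rw [vertex_eq_sum R a ha, Finset.smul_sum]
    refine sum_mem fun e he => ?_
    have : c • (edge R e * ghost R e) = edge R e * (c • vertex R (E.r e)) * ghost R e := by
      rw [mul_smul_comm, edge_mul_vertex, smul_mul_assoc]
    rw [this]
    exact A.mul_mem_right _ _ (A.mul_mem_left _ _ (h e (by simpa using he)))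
  subset_breaking := Set.empty_subset _

/-- The pair `smulPair A c` is nontrivial because it contains `a`; its value under `f` contains `c`,
but not `1` since `a ∉ A`. -/
theorem IsBasicGraded.mem_of_smul_vertex_mem (hA : IsBasicGraded A I) {a : E.Vertex} {c : R}
    (ha : vertex R a ∉ A) (hc : c • vertex R a ∈ A) : c ∈ I := by
  refine hA.mem_of_mem_saturatedFunction
    (p := ⟨smulPair A c, fun h => Set.eq_empty_iff_forall_notMem.1 h.1 a hc⟩)
    ⟨fun b hb => hb, fun b hb => hb.elim⟩ fun h1 => ha ?_
  have := h1.1 a hc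
  rwa [one_smul] at this

/-- The pair `(H, {a})` serves here: `1` in its value would put `a` into `S`. -/
theorem IsBasicGraded.mem_of_smul_breakingElement_mem (hA : IsBasicGraded A I) {a : E.Vertex}
    {c : R} (ha : a ∈ E.breakingVertices (idealPair A).H \ (idealPair A).S)
    (hc : c • breakingElement R (idealPair A).H a ha.1 ∈ A) : c ∈ I := by
  let p : E.AdmissiblePair := ⟨(idealPair A).H, {a}, (idealPair A).hereditary,
    (idealPair A).saturated, Set.singleton_subset_iff.2 ha.1⟩
  refine hA.mem_of_mem_saturatedFunction
    (p := ⟨p, fun h => Set.eq_empty_iff_forall_notMem.1 h.2 a rfl⟩)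
    ⟨fun b hb => smul_mem A c hb, ?_⟩ fun h1 => ha.2 ⟨ha.1, ?_⟩
  · intro b hb
    have hab : a = b := (Set.mem_singleton_iff.1 hb).symm
    subst hab
    exact hc
  · have := h1.2 a rfl
    rwa [one_smul] at this

theorem IsBasicGraded.mem_of_smul_quotientVertex_mem (hA : IsBasicGraded A I)
    {x : (idealPair A).quotientGraph.Vertex} {c : R}
    (hc : c • quotientVertex R (idealPair A) x ∈ A) : c ∈ I := by
  rcases x with a | ⟨a, ha⟩
  · change c • mainVertex R (idealPair A) a.1 ∈ A at hc
    by_cases h : a.1 ∈ E.breakingVertices (idealPair A).H \ (idealPair A).S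
    -- Compressing `P` by an edge `e` of its sum gives `e* P e = r(e)`, a vertex outside `H`.
    · obtain ⟨e, hs, hr⟩ := h.1.2.2.1
      refine hA.mem_of_smul_vertex_mem (a := E.r e) hr ?_
      have : c • vertex R (E.r e) =
          ghost R e * (c • mainVertex R (idealPair A) a.1) * edge R e := by
        rw [← hs, mul_smul_comm, ghost_mul_mainVertex hr, smul_mul_assoc, ghost_mul_edge]
      rw [this]
      exact A.mul_mem_right _ _ (A.mul_mem_left _ _ hc)
    · rw [mainVertex_of_notMem h] at hc
      exact hA.mem_of_smul_vertex_mem a.2 hc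
  · change c • (vertex R a - mainVertex R (idealPair A) a) ∈ A at hc
    rw [mainVertex_of_mem ha] at hc
    exact hA.mem_of_smul_breakingElement_mem ha hc

/-! ### The isomorphism -/

variable [Module (R ⧸ I) (QuotientAlgebra A)] [IsScalarTower R (R ⧸ I) (QuotientAlgebra A)]

instance isScalarTower_quotient :
    IsScalarTower (R ⧸ I) (QuotientAlgebra A) (QuotientAlgebra A) where
  smul_assoc c x y := by
    obtain ⟨c, rfl⟩ := Ideal.Quotient.mk_surjective c
    simp only [← Ideal.Quotient.algebraMap_eq, algebraMap_smul, smul_assoc]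

instance smulCommClass_quotient :
    SMulCommClass (R ⧸ I) (QuotientAlgebra A) (QuotientAlgebra A) where
  smul_comm c x y := by
    obtain ⟨c, rfl⟩ := Ideal.Quotient.mk_surjective c
    simp only [← Ideal.Quotient.algebraMap_eq, algebraMap_smul, smul_comm]

variable (A I) in
/-- The homomorphism from the Leavitt path algebra of the quotient graph to `L_R(E) / A`. -/
noncomputable def quotientGraphHom :
    LeavittPathAlgebra (R ⧸ I) (idealPair A).quotientGraph →ₙₐ[R ⧸ I] QuotientAlgebra A :=
  (quotientFamily A).lift (R ⧸ I)

theorem quotientGraphHom_vertex (x : (idealPair A).quotientGraph.Vertex) :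
    quotientGraphHom A I (vertex (R ⧸ I) x) = quotientMap A (quotientVertex R _ x) :=
  (quotientFamily A).lift_vertex x

theorem quotientGraphHom_edge (e : (idealPair A).quotientGraph.Edge) :
    quotientGraphHom A I (edge (R ⧸ I) e) = quotientMap A (edge R (baseEdge _ e) *
      quotientVertex R _ ((idealPair A).quotientGraph.r e)) :=
  (quotientFamily A).lift_edge e

theorem quotientGraphHom_ghost (e : (idealPair A).quotientGraph.Edge) :
    quotientGraphHom A I (ghost (R ⧸ I) e) = quotientMap A
      (quotientVertex R _ ((idealPair A).quotientGraph.r e) * ghost R (baseEdge _ e)) :=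
  (quotientFamily A).lift_ghost e

theorem quotientGraphHom_mk_smul (c : R)
    (z : LeavittPathAlgebra (R ⧸ I) (idealPair A).quotientGraph) :
    quotientGraphHom A I (Ideal.Quotient.mk I c • z) = c • quotientGraphHom A I z := by
  rw [map_smul, ← Ideal.Quotient.algebraMap_eq, algebraMap_smul]

theorem mainVertex_mem_degreeComponent (p : E.AdmissiblePair) (a : E.Vertex) :
    mainVertex R p a ∈ degreeComponent R E 0 := by
  by_cases h : a ∈ E.breakingVertices p.H \ p.S
  · rw [mainVertex_of_mem h]
    exact sum_mem fun e _ =>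
      mul_mem_degreeComponent (edge_mem_degreeComponent e) (ghost_mem_degreeComponent e)
  · rw [mainVertex_of_notMem h]
    exact vertex_mem_degreeComponent a

theorem quotientVertex_mem_degreeComponent (p : E.AdmissiblePair) (x : p.quotientGraph.Vertex) :
    quotientVertex R p x ∈ degreeComponent R E 0 := by
  rcases x with a | a
  · exact mainVertex_mem_degreeComponent p a.1
  · exact sub_mem (vertex_mem_degreeComponent a.1) (mainVertex_mem_degreeComponent p a.1)

/-- Generators have homogeneous representatives of the same degree in `L_R(E)`. This replaces a
grading on `L_R(E) / A`. -/
theorem exists_quotientMap_eq_of_isMonomial {m n : ℕ}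
    {z : LeavittPathAlgebra (R ⧸ I) (idealPair A).quotientGraph} (hz : IsMonomial _ _ m n z) :
    ∃ y ∈ degreeComponent R E (m - n), quotientMap A y = quotientGraphHom A I z := by
  induction hz with
  | vertex x => exact ⟨_, quotientVertex_mem_degreeComponent _ x, (quotientGraphHom_vertex x).symm⟩
  | @edge_mul m n z e _ ih =>
    obtain ⟨y, hy, hyz⟩ := ih
    refine ⟨_, ?_, by rw [map_mul (quotientGraphHom A I), quotientGraphHom_edge, ← hyz, ← map_mul]⟩
    have := mul_mem_degreeComponent (mul_mem_degreeComponent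
      (edge_mem_degreeComponent (baseEdge (idealPair A) e))
      (quotientVertex_mem_degreeComponent _ ((idealPair A).quotientGraph.r e))) hy
    convert this using 2
    push_cast
    ring
  | @mul_ghost m n z e _ ih =>
    obtain ⟨y, hy, hyz⟩ := ih
    refine ⟨_, ?_, by rw [map_mul (quotientGraphHom A I), quotientGraphHom_ghost, ← hyz, ← map_mul]⟩
    have := mul_mem_degreeComponent hy (mul_mem_degreeComponent
      (quotientVertex_mem_degreeComponent _ ((idealPair A).quotientGraph.r e))
      (ghost_mem_degreeComponent (baseEdge (idealPair A) e)))
    convert this using 2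
    push_cast
    ring

theorem exists_quotientMap_eq_of_mem_monomialSpan {d : ℤ}
    {z : LeavittPathAlgebra (R ⧸ I) (idealPair A).quotientGraph} (hz : z ∈ monomialSpan _ _ d) :
    ∃ y ∈ degreeComponent R E d, quotientMap A y = quotientGraphHom A I z := by
  induction hz using Submodule.span_induction with
  | mem z h =>
    obtain ⟨m, n, rfl, h⟩ := h
    exact exists_quotientMap_eq_of_isMonomial h
  | zero => exact ⟨0, zero_mem _, by rw [map_zero, map_zero]⟩
  | add z₁ z₂ _ _ h₁ h₂ =>
    obtain ⟨y₁, hy₁, h₁⟩ := h₁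
    obtain ⟨y₂, hy₂, h₂⟩ := h₂
    exact ⟨y₁ + y₂, add_mem hy₁ hy₂, by rw [map_add, map_add, h₁, h₂]⟩
  | smul c z _ h =>
    obtain ⟨c, rfl⟩ := Ideal.Quotient.mk_surjective c
    obtain ⟨y, hy, h⟩ := h
    exact ⟨c • y, Submodule.smul_mem _ c hy, by rw [quotientGraphHom_mk_smul, map_smul, h]⟩

theorem IsBasicGraded.quotientGraphHom_injective (hA : IsBasicGraded A I) :
    Function.Injective (quotientGraphHom A I) := by
  refine (injective_iff_map_eq_zero _).2 fun x hx => ?_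
  have hK : ∀ a (c : R ⧸ I), c • vertex (R ⧸ I) a ∈ TwoSidedIdeal.ker (quotientGraphHom A I) →
      c = 0 := by
    intro a c hc
    obtain ⟨c, rfl⟩ := Ideal.Quotient.mk_surjective c
    rw [TwoSidedIdeal.mem_ker, quotientGraphHom_mk_smul, quotientGraphHom_vertex, ← map_smul,
      quotientMap_eq_zero] at hc
    exact Ideal.Quotient.eq_zero_iff_mem.2 (hA.mem_of_smul_quotientVertex_mem hc)
  have hxt : x ∈ ⨆ d, monomialSpan (R ⧸ I) (idealPair A).quotientGraph d := by
    rw [iSup_monomialSpan]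
    trivial
  obtain ⟨f, hf, rfl⟩ := (Submodule.mem_iSup_iff_exists_finsupp _ _).1 hxt
  choose y hy hyf using fun d => exists_quotientMap_eq_of_mem_monomialSpan (hf d)
  -- The lifts `y d` add up to an element of `A`, so each of them lies in `A` and each component of
  -- `x` lies in the kernel.
  refine Finset.sum_eq_zero fun d hd => eq_zero_of_mem_monomialSpan hK (hf d) ?_
  rw [TwoSidedIdeal.mem_ker, ← hyf, quotientMap_eq_zero]
  refine hA.graded.mem_of_sum_mem (fun n _ => hy n) ?_ hd
  rw [← quotientMap_eq_zero, map_sum, ← hx, Finsupp.sum, map_sum]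
  exact Finset.sum_congr rfl fun n _ => hyf n

theorem exists_quotientGraphHom_eq_add {x y z : LeavittPathAlgebra R E} (h : x = y + z)
    (hy : ∃ t, quotientGraphHom A I t = quotientMap A y)
    (hz : ∃ t, quotientGraphHom A I t = quotientMap A z) :
    ∃ t, quotientGraphHom A I t = quotientMap A x := by
  obtain ⟨s, hs⟩ := hy
  obtain ⟨t, ht⟩ := hz
  exact ⟨s + t, by rw [h, map_add, map_add, hs, ht]⟩

theorem exists_quotientGraphHom_eq_zero {x : LeavittPathAlgebra R E} (h : x ∈ A) :
    ∃ t, quotientGraphHom A I t = quotientMap A x :=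
  ⟨0, by rw [map_zero, quotientMap_eq_zero.2 h]⟩

theorem quotientGraphHom_surjective : Function.Surjective (quotientGraphHom A I) := by
  let N : Submodule R (LeavittPathAlgebra R E) :=
    { carrier := {x | ∃ t, quotientGraphHom A I t = quotientMap A x}
      add_mem' := exists_quotientGraphHom_eq_add rfl
      zero_mem' := exists_quotientGraphHom_eq_zero A.zero_mem
      smul_mem' := fun c x ⟨t, ht⟩ =>
        ⟨Ideal.Quotient.mk I c • t, by rw [quotientGraphHom_mk_smul, map_smul, ht]⟩ }
  have hmul : ∀ {x y}, x ∈ N → y ∈ N → x * y ∈ N := by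
    rintro x y ⟨s, hs⟩ ⟨t, ht⟩
    exact ⟨s * t, by rw [map_mul, map_mul, hs, ht]⟩
  have hv : ∀ a, vertex R a ∈ N := by
    intro a
    by_cases ha : a ∈ (idealPair A).H
    · exact exists_quotientGraphHom_eq_zero ha
    -- The remainder `a - mainVertex` is the image of `a'` when `a ∈ B_H \ S`, and zero otherwise.
    -- Edges and ghost edges are split in the same way at their range.
    refine exists_quotientGraphHom_eq_add (add_sub_cancel (mainVertex R (idealPair A) a) _).symm
      ⟨_, quotientGraphHom_vertex (Sum.inl ⟨a, ha⟩)⟩ ?_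
    by_cases hb : a ∈ E.breakingVertices (idealPair A).H \ (idealPair A).S
    · exact ⟨_, quotientGraphHom_vertex (Sum.inr ⟨a, hb⟩)⟩
    · rw [mainVertex_of_notMem hb, sub_self]
      exact exists_quotientGraphHom_eq_zero A.zero_mem
  have he : ∀ e, edge R e ∈ N := by
    intro e
    by_cases hr : E.r e ∈ (idealPair A).H
    · exact exists_quotientGraphHom_eq_zero (edge_mem_of_range_mem hr)
    refine exists_quotientGraphHom_eq_add (y := edge R e * mainVertex R (idealPair A) (E.r e))
      (z := edge R e * (vertex R (E.r e) - mainVertex R (idealPair A) (E.r e)))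
      (by rw [← mul_add, add_sub_cancel, edge_mul_vertex])
      ⟨_, quotientGraphHom_edge (Sum.inl ⟨e, hr⟩)⟩ ?_
    by_cases hb : E.r e ∈ E.breakingVertices (idealPair A).H \ (idealPair A).S
    · exact ⟨_, quotientGraphHom_edge (Sum.inr ⟨e, hb⟩)⟩
    · rw [mainVertex_of_notMem hb, sub_self, mul_zero]
      exact exists_quotientGraphHom_eq_zero A.zero_mem
  have hg : ∀ e, ghost R e ∈ N := by
    intro e
    by_cases hr : E.r e ∈ (idealPair A).H
    · exact exists_quotientGraphHom_eq_zero (ghost_mem_of_range_mem hr)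
    refine exists_quotientGraphHom_eq_add (y := mainVertex R (idealPair A) (E.r e) * ghost R e)
      (z := (vertex R (E.r e) - mainVertex R (idealPair A) (E.r e)) * ghost R e)
      (by rw [← add_mul, add_sub_cancel, vertex_mul_ghost])
      ⟨_, quotientGraphHom_ghost (Sum.inl ⟨e, hr⟩)⟩ ?_
    by_cases hb : E.r e ∈ E.breakingVertices (idealPair A).H \ (idealPair A).S
    · exact ⟨_, quotientGraphHom_ghost (Sum.inr ⟨e, hb⟩)⟩
    · rw [mainVertex_of_notMem hb, sub_self, zero_mul]
      exact exists_quotientGraphHom_eq_zero A.zero_mem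
  have hN : N = ⊤ := eq_top_of_generators N hv he hg (fun a _ => hmul (hv a))
    (fun e _ => hmul (he e)) (fun e _ => hmul (hg e))
  intro b
  obtain ⟨x, rfl⟩ := quotientMap_surjective A b
  have hx : x ∈ N := hN ▸ Submodule.mem_top
  exact hx

end Basic

end LeavittPathAlgebra

/-! ### The corollary. -/

theorem corollary4p3 {R : Type w} [CommRing R] (E : DirectedGraph.{u, v})
    (A : TwoSidedIdeal (LeavittPathAlgebra R E)) (I : Ideal R)
    (hA : LeavittPathAlgebra.IsBasicGraded A I) :
    letI : Module (R ⧸ I) (LeavittPathAlgebra.QuotientAlgebra A) := hA.module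
    ∃ φ : LeavittPathAlgebra.QuotientAlgebra A →ₙₐ[R ⧸ I]
        LeavittPathAlgebra (R ⧸ I) (LeavittPathAlgebra.idealPair A).quotientGraph,
      Function.Bijective φ := by
  let _ : Module (R ⧸ I) (LeavittPathAlgebra.QuotientAlgebra A) := hA.module
  have : IsScalarTower R (R ⧸ I) (LeavittPathAlgebra.QuotientAlgebra A) :=
    hA.isTorsionBySet.isScalarTower
  obtain ⟨g, hl, hr⟩ := Function.bijective_iff_has_inverse.1
    ⟨hA.quotientGraphHom_injective, LeavittPathAlgebra.quotientGraphHom_surjective⟩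
  exact ⟨(LeavittPathAlgebra.quotientGraphHom A I).inverse g hl hr,
    hr.injective, hl.surjective⟩
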